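/- **Setting.** $N\ge 2$ agents play the same instance of a $K$-armed Bernoulli bandit, $K\ge 2$, with arm means $1>\mu_1>\mu_2\ge\cdots\ge\mu_K\ge 0$; put $\Delta_j=\mu_1-\mu_j$ and $c=\lceil K/N\rceil$. The gossip matrix $P$ is an $N\times N$ row-stochastic irreducible matrix, $\alpha>3$, $\varepsilon>0$, and the communication budget $(B_t)_{t\ge 0}$ is a non-negative, non-decreasing real sequence. Let $$A_x=\max\bigl(\min\{t\in\mathbb N: B_t\ge x\},\ \lceil(1+x)^{1+\varepsilon}\rceil\bigr),\quad x\in\mathbb N=\{0,1,\dots\},\qquad A_{-1}=0 .$$ Assume that for every $D>0$ one has $B_t\ge D\log t$ for all large $t$; that $A_{\lfloor\lambda x+(1-\lambda)y\rfloor}\le\lambda A_x+(1-\lambda)A_y$ for all $x,y\in\mathbb N$, $\lambda\in[0,1]$; and that $\sum_{l\ge2}A_{2l}/A_{l-1}^3<\infty$. **Algorithms.** Time slots are $t=1,2,\dots$. Agent $i$ has the sticky set $\widehat S^{(i)}$ of the $c$ cyclically consecutive arms $((i-1)c+r \bmod K)+1$, $0\le r<c$, and starts phase $0$ with $U_0^{(i)}=(ic\bmod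 K)+1$, $L_0^{(i)}=(ic+1\bmod K)+1$ and $S_0^{(i)}=\widehat S^{(i)}\cup\{U_0^{(i)},L_0^{(i)}\}$. In slot $t$ of its phase $j$ the agent pulls an arm $I^{(i)}_t\in S_j^{(i)}$ that maximizes $$\widehat\mu_l^{(i)}(t-1)+\sqrt{\alpha\ln t/T_l^{(i)}(t-1)},$$ where $T_l^{(i)}(t-1)$ is the number of its previous pulls of arm $l$ and $\widehat\mu_l^{(i)}(t-1)$ the empirical mean of their rewards; the index is $+\infty$ if $T_l^{(i)}(t-1)=0$. Rewards are independent, Bernoulli($\mu_l$) for arm $l$. In the last slot of phase $j$, after the pull, agent $i$ contacts an agent $m\sim P(i,\cdot)$, drawn independently of everything else, and receives an arm $O$. If $O\in S_j^{(i)}$, then $S,U,L$ stay unchanged in phase $j+1$. Otherwise $U_{j+1}^{(i)}$ is the one of $U_j^{(i)},L_j^{(i)}$ that the agent played more often in phase $j$, $L_{j+1}^{(i)}=O$ and $S_{j+1}^{(i)}=\widehat S^{(i)}\cup\{U_{j+1}^{(i)},L_{j+1}^{(i)}\}$. All ties are broken arbitrarily, possibly at random. * *Synchronous algorithm:* phase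 $j$ of every agent ends in slot $A_j$, and $O$ is an arm that agent $m$ played most in its phase $j$. * *Asynchronous algorithm with slack $\delta>0$:* phase $j$ of agent $i$ lasts $\mathcal P_j^{(i)}$ slots, where the $\mathcal P_j^{(i)}$ are independent of each other and of all rewards and contacts, and $\mathcal P_j^{(i)}$ is uniformly distributed on the integers in $[A_j-A_{j-1},(1+\delta)(A_j-A_{j-1})]$. If agent $m$ is in its phase $r$ in the current slot, then $O$ is an arm of $S^{(m)}_{r-1}$ that it played most in phase $r-1$ (for $r=0$: an arbitrary arm of $S_0^{(m)}$). **Claim.** Let $R_T^{(i)}=\sum_{t=1}^T(\mu_1-\mu_{I_t^{(i)}})$. For the synchronous algorithm, and for the asynchronous algorithm with any $\delta>0$, every agent $i$ satisfies $$\limsup_{T\to\infty}\frac{\mathbb E[R_T^{(i)}]}{\ln T}\ \le\ \sum_{j=2}^{\min(\lceil K/N\rceil+2,\,K)}\frac{4\alpha}{\Delta_j}.$$ In particular this bound on the asymptotic regret depends neither on $P$ nor on the communication budget (nor on $\varepsilon$, $\delta$). -/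

import Mathlib

open MeasureTheory ProbabilityTheory Filter

namespace GosInE

/-! ### The problem instance

There are `N` agents (`Fin N`) and `K` arms (`Fin K`), both numbered from `0`; arm `0` is the best
arm. -/

/-- Arm means `1 > μ₀ > μ₁ ≥ μ₂ ≥ ⋯ ≥ μ_{K-1} ≥ 0`. -/
structure IsBanditInstance {K : ℕ} [NeZero K] (μ : Fin K → ℝ) : Prop where
  lt_one : μ 0 < 1
  nonneg : ∀ l, 0 ≤ μ l
  antitone : Antitone μ
  best_unique : ∀ l, l ≠ 0 → μ l < μ 0

/-- The slot `A_x = max (min {t | B_t ≥ x}, ⌈(1 + x)^(1 + ε)⌉)` of the `x`-th information pull. -/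
noncomputable def commSlot (B : ℕ → ℝ) (ε : ℝ) (x : ℕ) : ℕ :=
  max (sInf {t : ℕ | (x : ℝ) ≤ B t}) ⌈(1 + (x : ℝ)) ^ (1 + ε)⌉₊

/-- The assumption on the communication budget `B` and the parameter `ε`. -/
structure IsAdmissibleBudget (B : ℕ → ℝ) (ε : ℝ) : Prop where
  nonneg : ∀ t, 0 ≤ B t
  monotone : Monotone B
  log_le : ∀ D : ℝ, 0 < D → ∃ t₀ : ℕ, ∀ t ≥ t₀, D * Real.log t ≤ B t
  convex : ∀ (x y : ℕ) (c : ℝ), 0 ≤ c → c ≤ 1 →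
    (commSlot B ε ⌊c * x + (1 - c) * y⌋₊ : ℝ) ≤
      c * commSlot B ε x + (1 - c) * commSlot B ε y
  /-- The series of `A_{2l} / A_{l-1}^3` over `l ≥ 2`, written with `l = n + 2`. -/
  summable : Summable fun n : ℕ =>
    (commSlot B ε (2 * (n + 2)) : ℝ) / (commSlot B ε (n + 1) : ℝ) ^ 3

/-! ### Playing sets -/

/-- The sticky set of an agent: the `⌈K/N⌉` cyclically consecutive arms that start at arm
`i ⌈K/N⌉ mod K` (agents and arms are numbered from `0`). -/
def sticky (N K : ℕ) [NeZero K] (i : Fin N) : Finset (Fin K) :=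
  (Finset.range (K ⌈/⌉ N)).image fun r => Fin.ofNat K (i * (K ⌈/⌉ N) + r)

/-- The two arms that follow the sticky set cyclically are the initial non-sticky arms. -/
def initU (N K : ℕ) [NeZero K] (i : Fin N) : Fin K :=
  Fin.ofNat K ((i + 1) * (K ⌈/⌉ N))

/-- See `initU`. -/
def initL (N K : ℕ) [NeZero K] (i : Fin N) : Fin K :=
  Fin.ofNat K ((i + 1) * (K ⌈/⌉ N) + 1)

open Classical in
/-- The maximizers of `f` over `S`. -/
noncomputable def argmaxSet {K : ℕ} {β : Type*} [LE β] (S : Finset (Fin K)) (f : Fin K → β) :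
    Finset (Fin K) :=
  S.filter fun l => ∀ m ∈ S, f m ≤ f l

/-- A way of breaking the ties in the three kinds of `argmax` of the algorithms. Each function
receives an agent, a time slot and the set of maximizers, and picks an element of that set. -/
structure TieBreak (N K : ℕ) where
  /-- the arm to be pulled by the agent -/
  pull : Fin N → ℕ → Finset (Fin K) → Fin K
  /-- the arm that the agent recommends when it is contacted -/
  recommend : Fin N → ℕ → Finset (Fin K) → Fin K
  /-- the non-sticky arm that the agent keeps -/
  keep : Fin N → ℕ → Finset (Fin K) → Fin K
  pull_mem : ∀ i t s, s.Nonempty → pull i t s ∈ s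
  recommend_mem : ∀ i t s, s.Nonempty → recommend i t s ∈ s
  keep_mem : ∀ i t s, s.Nonempty → keep i t s ∈ s

/-! ### The algorithms -/

/-- What an agent remembers between two time slots. -/
structure AgentState (K : ℕ) where
  /-- the number `j` of the current phase -/
  phase : ℕ
  /-- the playing set `S_j` -/
  active : Finset (Fin K)
  /-- the non-sticky arm `U_j` -/
  U : Fin K
  /-- the non-sticky arm `L_j` -/
  L : Fin K
  /-- the number of pulls of each arm so far -/
  pulls : Fin K → ℕ
  /-- the number of pulls of each arm in the current phase so far -/
  phasePulls : Fin K → ℕ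
  /-- the playing set of the previous phase -/
  prevActive : Finset (Fin K)
  /-- the number of pulls of each arm in the previous phase -/
  prevPulls : Fin K → ℕ

/-- The state before the first slot. The (fictitious) phase before phase `0` has the same playing
set and no pulls. -/
def initState (N K : ℕ) [NeZero K] (i : Fin N) : AgentState K where
  phase := 0
  active := sticky N K i ∪ {initU N K i, initL N K i}
  U := initU N K i
  L := initL N K i
  pulls := 0
  phasePulls := 0
  prevActive := sticky N K i ∪ {initU N K i, initL N K i}
  prevPulls := 0

/-- The mean of the first `n` rewards of an arm whose successive rewards are `y 0, y 1, …`. -/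
noncomputable def empMean (y : ℕ → Bool) (n : ℕ) : ℝ :=
  (∑ s ∈ Finset.range n, if y s then (1 : ℝ) else 0) / n

/-- The index of arm `l` in slot `t`. Arms that were never pulled have an infinite index. -/
noncomputable def ucbIndex {K : ℕ} (α : ℝ) (y : Fin K → ℕ → Bool) (t : ℕ) (pulls : Fin K → ℕ)
    (l : Fin K) : EReal :=
  if pulls l = 0 then ⊤
  else ((empMean (y l) (pulls l) + √(α * Real.log t / pulls l) : ℝ) : EReal)

/-- The bookkeeping for one pull of `arm`. -/
def AgentState.play {K : ℕ} (st : AgentState K) (arm : Fin K) : AgentState K :=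
  { st with
    pulls := Function.update st.pulls arm (st.pulls arm + 1)
    phasePulls := Function.update st.phasePulls arm (st.phasePulls arm + 1) }

/-- The passage to the next phase of an agent with sticky set `stick`, after it has received the
recommendation `O`; `keep` breaks the ties between `U` and `L`. -/
noncomputable def AgentState.nextPhase {K : ℕ} (st : AgentState K) (stick : Finset (Fin K))
    (keep : Finset (Fin K) → Fin K) (O : Fin K) : AgentState K :=
  if O ∈ st.active then
    { st with
      phase := st.phase + 1
      phasePulls := 0
      prevActive := st.active
      prevPulls := st.phasePulls }
  else
    { phase := st.phase + 1
      active := stick ∪ {keep (argmaxSet {st.U, st.L} st.phasePulls), O}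
      U := keep (argmaxSet {st.U, st.L} st.phasePulls)
      L := O
      pulls := st.pulls
      phasePulls := 0
      prevActive := st.active
      prevPulls := st.phasePulls }

section Run

variable {N K : ℕ} [NeZero K]

/-- The arm pulled by agent `i` in slot `t`, if `st` are the states before that slot.
`Y i l s` is the reward that agent `i` gets from its pull number `s` (from `0`) of arm `l`. -/
noncomputable def pulledArm (α : ℝ) (tie : TieBreak N K) (Y : Fin N → Fin K → ℕ → Bool)
    (t : ℕ) (st : Fin N → AgentState K) (i : Fin N) : Fin K :=
  tie.pull i t (argmaxSet (st i).active (ucbIndex α (Y i) t (st i).pulls))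

/-- One time slot of either algorithm. All agents pull an arm; then every agent `i` whose current
phase ends in this slot contacts agent `Z i j`, where `j` is the number of that phase, and
receives one of the arms in `advice st`, where `st` is the state of the contacted agent after the
arm-pulling part of this slot. `phaseEnd i j` is the last slot of phase `j` of agent `i`. -/
noncomputable def step (α : ℝ) (tie : TieBreak N K) (Y : Fin N → Fin K → ℕ → Bool)
    (Z : Fin N → ℕ → Fin N) (phaseEnd : Fin N → ℕ → ℕ)
    (advice : AgentState K → Finset (Fin K))
    (t : ℕ) (st : Fin N → AgentState K) : Fin N → AgentState K := fun i =>
  let played : Fin N → AgentState K := fun k => (st k).play (pulledArm α tie Y t st k)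
  if t = phaseEnd i (st i).phase then
    let m := Z i (st i).phase
    (played i).nextPhase (sticky N K i) (tie.keep i t) (tie.recommend m t (advice (played m)))
  else played i

/-- The states after slot `t`; the slots are `1, 2, 3, …`. -/
noncomputable def states (α : ℝ) (tie : TieBreak N K) (Y : Fin N → Fin K → ℕ → Bool)
    (Z : Fin N → ℕ → Fin N) (phaseEnd : Fin N → ℕ → ℕ)
    (advice : AgentState K → Finset (Fin K)) : ℕ → Fin N → AgentState K
  | 0 => initState N K
  | t + 1 => step α tie Y Z phaseEnd advice (t + 1) (states α tie Y Z phaseEnd advice t)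

/-- The regret `∑_{t=1}^T (μ₀ - μ_{I_t})` of agent `i`, where `I_t` is its arm in slot `t`. -/
noncomputable def regret (μ : Fin K → ℝ) (α : ℝ) (tie : TieBreak N K)
    (Y : Fin N → Fin K → ℕ → Bool) (Z : Fin N → ℕ → Fin N) (phaseEnd : Fin N → ℕ → ℕ)
    (advice : AgentState K → Finset (Fin K)) (i : Fin N) (T : ℕ) : ℝ :=
  ∑ t ∈ Finset.range T,
    (μ 0 - μ (pulledArm α tie Y (t + 1) (states α tie Y Z phaseEnd advice t) i))

/-- Regret of the synchronous algorithm: phase `j` of every agent ends in slot `A_j`, and agents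
recommend an arm that they played most in the phase that ends in the current slot. -/
noncomputable def syncRegret (μ : Fin K → ℝ) (α : ℝ) (A : ℕ → ℕ) (tie : TieBreak N K)
    (Y : Fin N → Fin K → ℕ → Bool) (Z : Fin N → ℕ → Fin N) (i : Fin N) (T : ℕ) : ℝ :=
  regret μ α tie Y Z (fun _ j => A j) (fun st => argmaxSet st.active st.phasePulls) i T

/-- Regret of the asynchronous algorithm: phase `j` of agent `i` lasts `W i j` slots, and agents
recommend an arm that they played most in the phase before their current one. -/
noncomputable def asyncRegret (μ : Fin K → ℝ) (α : ℝ) (tie : TieBreak N K)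
    (Y : Fin N → Fin K → ℕ → Bool) (Z : Fin N → ℕ → Fin N) (W : Fin N → ℕ → ℕ)
    (i : Fin N) (T : ℕ) : ℝ :=
  regret μ α tie Y Z (fun k j => ∑ y ∈ Finset.range (j + 1), W k y)
    (fun st => argmaxSet st.prevActive st.prevPulls) i T

end Run

/-! ### The randomness -/

section Randomness

variable {N K : ℕ} {Ω : Type*} [MeasurableSpace Ω]

/-- The rewards `Y i l s` are Bernoulli variables with mean `μ l`, the contacted agents `Z i j`
have the distribution `P i`, and all these variables are independent. -/
structure IsNoise (μ : Fin K → ℝ) (P : Matrix (Fin N) (Fin N) ℝ)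
    (Y : Ω → Fin N → Fin K → ℕ → Bool) (Z : Ω → Fin N → ℕ → Fin N) (Pr : Measure Ω) :
    Prop where
  measurable_reward : Measurable Y
  measurable_contact : Measurable Z
  reward_law : ∀ i l s, Pr {ω | Y ω i l s = true} = ENNReal.ofReal (μ l)
  contact_law : ∀ i j m, Pr {ω | Z ω i j = m} = ENNReal.ofReal (P i m)
  indep_reward : iIndepFun (fun (x : Fin N × Fin K × ℕ) ω => Y ω x.1 x.2.1 x.2.2) Pr
  indep_contact : iIndepFun (fun (x : Fin N × ℕ) ω => Z ω x.1 x.2) Pr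
  indep_reward_contact : IndepFun Y Z Pr

/-- The tie-breaking may be random. -/
structure MeasurableTies (tie : Ω → TieBreak N K) : Prop where
  pull : ∀ i t s, Measurable fun ω => (tie ω).pull i t s
  recommend : ∀ i t s, Measurable fun ω => (tie ω).recommend i t s
  keep : ∀ i t s, Measurable fun ω => (tie ω).keep i t s

/-- `A_j - A_{j-1}`, with `A_{-1} = 0`. -/
def gap (A : ℕ → ℕ) : ℕ → ℕ
  | 0 => A 0
  | j + 1 => A (j + 1) - A j

/-- The integers in the interval `[A_j - A_{j-1}, (1 + δ) (A_j - A_{j-1})]`. -/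
noncomputable def phaseLengthRange (A : ℕ → ℕ) (δ : ℝ) (j : ℕ) : Finset ℕ :=
  Finset.Icc (gap A j) ⌊(1 + δ) * gap A j⌋₊

/-- The phase lengths `W i j` are uniformly distributed on the integers in
`[A_j - A_{j-1}, (1 + δ) (A_j - A_{j-1})]`, independent of each other and of the rewards and the
contacted agents. -/
structure IsPhaseLengths (A : ℕ → ℕ) (δ : ℝ) (Y : Ω → Fin N → Fin K → ℕ → Bool)
    (Z : Ω → Fin N → ℕ → Fin N) (W : Ω → Fin N → ℕ → ℕ) (Pr : Measure Ω) : Prop where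
  measurable : Measurable W
  law : ∀ i j, ∀ n ∈ phaseLengthRange A δ j,
    Pr {ω | W ω i j = n} = ((phaseLengthRange A δ j).card : ENNReal)⁻¹
  indep : iIndepFun (fun (x : Fin N × ℕ) ω => W ω x.1 x.2) Pr
  indep_noise : IndepFun (fun ω => (Y ω, Z ω)) W Pr

end Randomness

end GosInE

open GosInE

/-!
The argument is deterministic on an event of large probability, so the ties may be broken in any
way, even with knowledge of the future, and no independence between rewards, contacts and phase
lengths is used.

By Hoeffding's inequality and a union bound, with probability `1 - O(s⁻³)` every empirical mean is
within its confidence radius in all slots after `s`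
(`IsNoise.measure_not_accurateAfter_le`). On this event an agent that has arm `0` pulls a suboptimal
arm `l` only `4 α ln t / Δ_l ^ 2 + 1` times up to slot `t` (`Run.IsAccurate.pulls_le_of_arm`).
The phases outgrow the logarithm (`exists_log_lt_gap`), so arm `0` is the only most played arm of
every later phase of such an agent (`Run.IsAccurate.played_phasePulls_lt`); hence the agent keeps arm
`0` and recommends it.

Some agent has arm `0` in its sticky set. By irreducibility every agent is joined to it by a path of
bounded length `H` of possible contacts, and with probability exponentially close to `1` each
window of `L` consecutive phases of an agent contains every possible contact of that agent
(`IsNoise.measure_not_contact_le`). So arm `0` reaches all agents after `H` rounds of about `L`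
phases. As the gaps `A_j - A_{j-1}` grow and a phase is at most `M` times as long as its gap, a round
that starts by slot `A_a` is over by slot `A_{a + (M + 1) (L + 3)}`, even though the phases of
asynchronous agents drift apart (`IsTimetable.end_le_schedule`, `Run.IsAccurate.spread_step`).
With `L` a small multiple of `l`, and concentration after slot `A_l`, all playing sets contain arm
`0` and are frozen by slot `A_{2 l}` (`Run.IsAccurate.regret_le`). From then on each of the at most
`⌈K / N⌉ + 1` suboptimal arms of a playing set costs `4 α ln T / Δ_l + O(1)`.

The failure probability at level `l` is `O(A_l⁻³)` plus an exponentially small term. The assumption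
on the series of `A_{2 l} / A_{l - 1} ^ 3` takes care of the first contribution to the expected time
of freezing. The assumption that the budget exceeds every multiple of the logarithm makes
`A_l` subexponential (`exists_commSlot_le_exp`) and takes care of the second. So the expected regret
before freezing is bounded (`summable_commSlot_mul`, `limsup_regret_le`).
-/

namespace GosInE

/-! ### Timetables -/

/-- The number of slots before phase `j` of an agent whose phases end in the slots
`E 0, E 1, …`. -/
def phaseStart (E : ℕ → ℕ) : ℕ → ℕ
  | 0 => 0
  | j + 1 => E j

/-- The two properties of the communication slots `A` on which the analysis of the phases rests:
slots are numbered from `1`, and the gaps grow. -/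
structure IsConvexSchedule (A : ℕ → ℕ) : Prop where
  pos : 0 < A 0
  gap_mono : Monotone (gap A)

/-- Phase `j` of an agent lasts between `gap A j` and `M * gap A j` slots. Synchronous phases
satisfy this with `M = 1`, asynchronous ones with `M = ⌈1 + δ⌉`. -/
structure IsTimetable (A : ℕ → ℕ) (M : ℕ) (E : ℕ → ℕ) : Prop where
  le_end : ∀ j, phaseStart E j + gap A j ≤ E j
  end_le : ∀ j, E j ≤ phaseStart E j + M * gap A j

section Schedule

variable {A : ℕ → ℕ} {M : ℕ} {E : ℕ → ℕ}

lemma IsConvexSchedule.gap_pos (hA : IsConvexSchedule A) (j : ℕ) : 0 < gap A j :=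
  lt_of_lt_of_le hA.pos (hA.gap_mono (Nat.zero_le j))

lemma IsConvexSchedule.succ (hA : IsConvexSchedule A) (j : ℕ) :
    A (j + 1) = A j + gap A (j + 1) := by
  have h := hA.gap_pos (j + 1)
  simp only [gap] at h ⊢
  omega

lemma IsConvexSchedule.strictMono (hA : IsConvexSchedule A) : StrictMono A :=
  strictMono_nat_of_lt_succ fun j => by
    have := hA.gap_pos (j + 1)
    rw [hA.succ j]
    omega

lemma IsConvexSchedule.add_gap_mul_le (hA : IsConvexSchedule A) (b n : ℕ) :
    A b + n * gap A (b + 1) ≤ A (b + n) := by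
  induction n with
  | zero => simp
  | succ n ih =>
    have h1 := hA.succ (b + n)
    have h2 : gap A (b + 1) ≤ gap A (b + n + 1) := hA.gap_mono (by omega)
    rw [← add_assoc, h1, Nat.succ_mul]
    omega

lemma IsTimetable.strictMono (hA : IsConvexSchedule A) (hE : IsTimetable A M E) : StrictMono E :=
  strictMono_nat_of_lt_succ fun j => by
    have h1 := hA.gap_pos (j + 1)
    have h2 := hE.le_end (j + 1)
    simp only [phaseStart] at h2
    omega

lemma IsTimetable.zero_pos (hA : IsConvexSchedule A) (hE : IsTimetable A M E) : 0 < E 0 := by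
  have h1 := hA.gap_pos 0
  have h2 := hE.le_end 0
  omega

lemma IsTimetable.schedule_le (hA : IsConvexSchedule A) (hE : IsTimetable A M E) (j : ℕ) :
    A j ≤ E j := by
  induction j with
  | zero => simpa [phaseStart, gap] using hE.le_end 0
  | succ j ih =>
    have h2 := hE.le_end (j + 1)
    simp only [phaseStart] at h2
    rw [hA.succ j]
    omega

lemma IsTimetable.le_mul_schedule (hA : IsConvexSchedule A) (hE : IsTimetable A M E) (j : ℕ) :
    E j ≤ M * A j := by
  induction j with
  | zero => simpa [phaseStart, gap] using hE.end_le 0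
  | succ j ih =>
    have h2 := hE.end_le (j + 1)
    simp only [phaseStart] at h2
    rw [hA.succ j, Nat.mul_add]
    omega

lemma phaseStart_mono (hE : StrictMono E) : Monotone (phaseStart E) :=
  monotone_nat_of_le_succ fun j => by
    cases j with
    | zero => exact Nat.zero_le _
    | succ j => exact hE.monotone (Nat.le_succ j)

lemma IsTimetable.end_add_le (hE : IsTimetable A M E) (hA : IsConvexSchedule A) (q n : ℕ) :
    E (q + n) ≤ phaseStart E q + M * (n + 1) * gap A (q + n) := by
  induction n with
  | zero => simpa using hE.end_le q
  | succ n ih =>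
    have h1 := hE.end_le (q + n + 1)
    simp only [phaseStart] at h1
    have h2 : gap A (q + n) ≤ gap A (q + n + 1) := hA.gap_mono (by omega)
    have h3 : M * (n + 1) * gap A (q + n) ≤ M * (n + 1) * gap A (q + n + 1) :=
      Nat.mul_le_mul_left _ h2
    calc E (q + (n + 1)) ≤ E (q + n) + M * gap A (q + n + 1) := h1
      _ ≤ phaseStart E q + (M * (n + 1) * gap A (q + n + 1) + M * gap A (q + n + 1)) := by omega
      _ = _ := by rw [← add_assoc q n 1]; ring

/-- Although the phases of different agents drift apart, `n + 1` consecutive phases from the one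
that is running in slot `A a` on are over by the slot `A (a + (M + 1) * (n + 1))`: the gaps grow, so
the phases of a slow agent are at most `M` times as long as the gaps after `A a`. -/
lemma IsTimetable.end_le_schedule (hE : IsTimetable A M E) (hA : IsConvexSchedule A)
    {a q : ℕ} (hq : phaseStart E q ≤ A a) (n : ℕ) :
    E (q + n) ≤ A (a + (M + 1) * (n + 1)) := by
  have hqa : q ≤ a + 1 := by
    rcases q with _ | q
    · omega
    · have : A q ≤ A a := (hE.schedule_le hA q).trans hq
      have := hA.strictMono.le_iff_le.1 this
      omega
  have h1 := hE.end_add_le hA q n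
  have h2 : gap A (q + n) ≤ gap A (a + n + 1) := hA.gap_mono (by omega)
  have h3 := hA.add_gap_mul_le (a + n) (M * (n + 1))
  have h4 : M * (n + 1) * gap A (q + n) ≤ M * (n + 1) * gap A (a + n + 1) :=
    Nat.mul_le_mul_left _ h2
  have h5 : A a ≤ A (a + n) := hA.strictMono.monotone (by omega)
  have h6 : A (a + n + M * (n + 1)) ≤ A (a + (M + 1) * (n + 1)) := by
    apply hA.strictMono.monotone
    have : (M + 1) * (n + 1) = M * (n + 1) + (n + 1) := by ring
    omega
  omega

end Schedule

/-! ### Runs -/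

/-- Everything that determines a run of either algorithm. -/
structure Run (N K : ℕ) where
  /-- the exploration parameter -/
  α : ℝ
  /-- the breaking of ties -/
  tie : TieBreak N K
  /-- the rewards -/
  Y : Fin N → Fin K → ℕ → Bool
  /-- the contacted agents -/
  Z : Fin N → ℕ → Fin N
  /-- the last slots of the phases -/
  phaseEnd : Fin N → ℕ → ℕ
  /-- the arms that an agent may recommend -/
  advice : AgentState K → Finset (Fin K)

lemma mem_argmaxSet {K : ℕ} {β : Type*} [LE β] {S : Finset (Fin K)} {f : Fin K → β} {l : Fin K} :
    l ∈ argmaxSet S f ↔ l ∈ S ∧ ∀ m ∈ S, f m ≤ f l := by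
  simp [argmaxSet]

lemma argmaxSet_nonempty {K : ℕ} {β : Type*} [LinearOrder β] {S : Finset (Fin K)}
    (hS : S.Nonempty) (f : Fin K → β) : (argmaxSet S f).Nonempty := by
  obtain ⟨l, hl, h⟩ := S.exists_max_image f hS
  exact ⟨l, mem_argmaxSet.2 ⟨hl, h⟩⟩

lemma argmaxSet_eq_singleton {K : ℕ} {β : Type*} [LinearOrder β] {S : Finset (Fin K)}
    {f : Fin K → β} {a : Fin K} (ha : a ∈ S) (h : ∀ l, l ≠ a → f l < f a) :
    argmaxSet S f = {a} := by
  ext l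
  simp only [mem_argmaxSet, Finset.mem_singleton]
  constructor
  · rintro ⟨-, hm⟩
    by_contra hne
    exact absurd (hm a ha) (not_le.2 (h l hne))
  · rintro rfl
    refine ⟨ha, fun m _ => ?_⟩
    by_cases hm : m = l
    · rw [hm]
    · exact (h m hm).le

namespace AgentState

variable {K : ℕ}

lemma nextPhase_phase (st : AgentState K) (s k O) : (st.nextPhase s k O).phase = st.phase + 1 := by
  unfold AgentState.nextPhase
  split <;> rfl

lemma nextPhase_phasePulls (st : AgentState K) (s k O) : (st.nextPhase s k O).phasePulls = 0 := by
  unfold AgentState.nextPhase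
  split <;> rfl

lemma nextPhase_pulls (st : AgentState K) (s k O) : (st.nextPhase s k O).pulls = st.pulls := by
  unfold AgentState.nextPhase
  split <;> rfl

lemma nextPhase_prevActive (st : AgentState K) (s k O) :
    (st.nextPhase s k O).prevActive = st.active := by
  unfold AgentState.nextPhase
  split <;> rfl

lemma nextPhase_prevPulls (st : AgentState K) (s k O) :
    (st.nextPhase s k O).prevPulls = st.phasePulls := by
  unfold AgentState.nextPhase
  split <;> rfl

lemma mem_nextPhase_active (st : AgentState K) (s k O) : O ∈ (st.nextPhase s k O).active := by
  unfold AgentState.nextPhase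
  split
  · assumption
  · simp

lemma nextPhase_active_of_mem (st : AgentState K) (s k) {O} (h : O ∈ st.active) :
    (st.nextPhase s k O).active = st.active := by
  unfold AgentState.nextPhase
  rw [if_pos h]

end AgentState

namespace Run

variable {N K : ℕ} [NeZero K] (G : Run N K)

/-- The states after slot `t`. -/
noncomputable def state (t : ℕ) : Fin N → AgentState K :=
  states G.α G.tie G.Y G.Z G.phaseEnd G.advice t

/-- The arm that agent `i` pulls in slot `t + 1`. -/
noncomputable def arm (t : ℕ) (i : Fin N) : Fin K :=
  pulledArm G.α G.tie G.Y (t + 1) (G.state t) i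

/-- The state of agent `i` in slot `t + 1` after the pull and before the communication. -/
noncomputable def played (t : ℕ) (i : Fin N) : AgentState K :=
  (G.state t i).play (G.arm t i)

/-- The arm that agent `i` would receive if it communicated in slot `t + 1`. -/
noncomputable def received (t : ℕ) (i : Fin N) : Fin K :=
  G.tie.recommend (G.Z i (G.state t i).phase) (t + 1)
    (G.advice (G.played t (G.Z i (G.state t i).phase)))

lemma state_zero (i : Fin N) : G.state 0 i = initState N K i := rfl

lemma state_succ_of_ne {t : ℕ} {i : Fin N} (h : t + 1 ≠ G.phaseEnd i (G.state t i).phase) :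
    G.state (t + 1) i = G.played t i := by
  change step _ _ _ _ _ _ _ _ _ = _
  exact if_neg h

lemma state_succ_of_eq {t : ℕ} {i : Fin N} (h : t + 1 = G.phaseEnd i (G.state t i).phase) :
    G.state (t + 1) i = (G.played t i).nextPhase (sticky N K i) (G.tie.keep i (t + 1))
      (G.received t i) := by
  change step _ _ _ _ _ _ _ _ _ = _
  exact if_pos h

lemma active_eq (t : ℕ) (i : Fin N) :
    (G.state t i).active = sticky N K i ∪ {(G.state t i).U, (G.state t i).L} := by
  induction t with
  | zero => rfl
  | succ t ih =>
    by_cases h : t + 1 = G.phaseEnd i (G.state t i).phase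
    · rw [G.state_succ_of_eq h]
      unfold AgentState.nextPhase
      split
      · exact ih
      · rfl
    · rw [G.state_succ_of_ne h]
      exact ih

lemma card_active_le (t : ℕ) (i : Fin N) : (G.state t i).active.card ≤ K ⌈/⌉ N + 2 := by
  rw [G.active_eq]
  refine (Finset.card_union_le _ _).trans (add_le_add ?_ Finset.card_le_two)
  exact Finset.card_image_le.trans (by simp)

lemma active_nonempty (t : ℕ) (i : Fin N) : (G.state t i).active.Nonempty := by
  rw [G.active_eq]
  exact ⟨(G.state t i).U, by simp⟩

lemma arm_mem_argmaxSet (t : ℕ) (i : Fin N) :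
    G.arm t i ∈ argmaxSet (G.state t i).active
      (ucbIndex G.α (G.Y i) (t + 1) (G.state t i).pulls) :=
  G.tie.pull_mem _ _ _ (argmaxSet_nonempty (G.active_nonempty t i) _)

lemma arm_mem_active (t : ℕ) (i : Fin N) : G.arm t i ∈ (G.state t i).active :=
  (mem_argmaxSet.1 (G.arm_mem_argmaxSet t i)).1

lemma state_succ_pulls (t : ℕ) (i : Fin N) :
    (G.state (t + 1) i).pulls = (G.played t i).pulls := by
  by_cases h : t + 1 = G.phaseEnd i (G.state t i).phase
  · rw [G.state_succ_of_eq h, AgentState.nextPhase_pulls]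
  · rw [G.state_succ_of_ne h]

lemma pulls_succ (t : ℕ) (i : Fin N) (l : Fin K) :
    (G.state (t + 1) i).pulls l = (G.state t i).pulls l + if G.arm t i = l then 1 else 0 := by
  rw [state_succ_pulls]
  change Function.update _ _ _ _ = _
  by_cases h : G.arm t i = l
  · subst h; simp
  · rw [Function.update_of_ne (Ne.symm h)]; simp [h]

lemma played_phasePulls (t : ℕ) (i : Fin N) (l : Fin K) :
    (G.played t i).phasePulls l =
      (G.state t i).phasePulls l + if G.arm t i = l then 1 else 0 := by
  change Function.update _ _ _ _ = _
  by_cases h : G.arm t i = l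
  · subst h; simp
  · rw [Function.update_of_ne (Ne.symm h)]; simp [h]

lemma pulls_eq_card (t : ℕ) (i : Fin N) (l : Fin K) :
    (G.state t i).pulls l = ((Finset.range t).filter fun s => G.arm s i = l).card := by
  induction t with
  | zero => rfl
  | succ t ih =>
    rw [pulls_succ, ih, Finset.range_add_one, Finset.filter_insert]
    split <;> simp

lemma pulls_le (t : ℕ) (i : Fin N) (l : Fin K) : (G.state t i).pulls l ≤ t := by
  rw [pulls_eq_card]
  exact (Finset.card_filter_le _ _).trans (by simp)

lemma phasePulls_le_pulls (t : ℕ) (i : Fin N) (l : Fin K) :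
    (G.state t i).phasePulls l ≤ (G.state t i).pulls l := by
  induction t with
  | zero => exact le_rfl
  | succ t ih =>
    by_cases h : t + 1 = G.phaseEnd i (G.state t i).phase
    · rw [G.state_succ_of_eq h, AgentState.nextPhase_phasePulls]
      exact Nat.zero_le _
    · rw [pulls_succ, G.state_succ_of_ne h, played_phasePulls]
      omega

/-! ### The timing of the phases -/

section Phases

variable {G} {A : ℕ → ℕ} {M : ℕ}

lemma phase_spec (hA : IsConvexSchedule A) (hE : ∀ i, IsTimetable A M (G.phaseEnd i)) (t : ℕ)
    (i : Fin N) :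
    phaseStart (G.phaseEnd i) (G.state t i).phase ≤ t ∧
      t < G.phaseEnd i (G.state t i).phase := by
  induction t with
  | zero => exact ⟨le_rfl, (hE i).zero_pos hA⟩
  | succ t ih =>
    by_cases h : t + 1 = G.phaseEnd i (G.state t i).phase
    · rw [G.state_succ_of_eq h, AgentState.nextPhase_phase]
      refine ⟨h.ge, ?_⟩
      change t + 1 < G.phaseEnd i ((G.state t i).phase + 1)
      conv_lhs => rw [h]
      exact (hE i).strictMono hA (Nat.lt_succ_self _)
    · rw [G.state_succ_of_ne h]
      change phaseStart _ (G.state t i).phase ≤ _ ∧ _ < G.phaseEnd i (G.state t i).phase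
      omega

lemma lt_phase_of_end_le (hA : IsConvexSchedule A) (hE : ∀ i, IsTimetable A M (G.phaseEnd i))
    {t j : ℕ} {i : Fin N} (h : G.phaseEnd i j ≤ t) : j < (G.state t i).phase := by
  have := (phase_spec hA hE t i).2
  exact ((hE i).strictMono hA).lt_iff_lt.1 (h.trans_lt this)

lemma phase_le_of_start_le (hA : IsConvexSchedule A) (hE : ∀ i, IsTimetable A M (G.phaseEnd i))
    {t j : ℕ} {i : Fin N} (h : t < G.phaseEnd i j) : (G.state t i).phase ≤ j := by
  have h1 := (phase_spec hA hE t i).1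
  rcases hp : (G.state t i).phase with _ | p
  · exact Nat.zero_le _
  · rw [hp] at h1
    exact ((hE i).strictMono hA).lt_iff_lt.1 (lt_of_le_of_lt h1 h)

lemma sum_phasePulls (t : ℕ) (i : Fin N) :
    phaseStart (G.phaseEnd i) (G.state t i).phase + ∑ l, (G.state t i).phasePulls l = t := by
  induction t with
  | zero => simp [state_zero, initState, phaseStart]
  | succ t ih =>
    by_cases h : t + 1 = G.phaseEnd i (G.state t i).phase
    · rw [G.state_succ_of_eq h, AgentState.nextPhase_phase, AgentState.nextPhase_phasePulls]
      simp only [Pi.zero_apply, Finset.sum_const_zero, add_zero]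
      exact h.symm
    · rw [G.state_succ_of_ne h]
      change phaseStart _ (G.state t i).phase + _ = _
      simp only [played_phasePulls, Finset.sum_add_distrib, Finset.sum_ite_eq, Finset.mem_univ,
        if_true]
      omega

end Phases
end Run
/-! ### The best arm on the concentration event -/

/-- After slot `s`, every empirical mean that can enter a UCB index is within its confidence
radius. -/
def AccurateAfter {N K : ℕ} (μ : Fin K → ℝ) (α : ℝ) (Y : Fin N → Fin K → ℕ → Bool) (s : ℕ) : Prop :=
  ∀ t, s < t → ∀ i l n, 0 < n → n ≤ t →
    |empMean (Y i l) n - μ l| ≤ √(α * Real.log t / n)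

namespace Run

variable {N K : ℕ} [NeZero K]

/-- A run on the concentration event after slot `s`. The constant `C` bounds `4 α / Δ_l ^ 2` for
every suboptimal arm `l`, and every phase that starts after slot `s` is too long to be filled with
the pulls of suboptimal arms that the confidence radii allow. The condition on `advice` covers both
algorithms. -/
structure IsAccurate (G : Run N K) (μ : Fin K → ℝ) (A : ℕ → ℕ) (M : ℕ) (C : ℝ) (s : ℕ) : Prop where
  bandit : IsBanditInstance μ
  alpha_pos : 0 < G.α
  schedule : IsConvexSchedule A
  timetable : ∀ i, IsTimetable A M (G.phaseEnd i)
  advice : (G.advice = (fun st => argmaxSet st.active st.phasePulls) ∧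
      ∀ i k, G.phaseEnd i = G.phaseEnd k) ∨
    G.advice = fun st => argmaxSet st.prevActive st.prevPulls
  accurate : AccurateAfter μ G.α G.Y s
  le_const : ∀ l, l ≠ 0 → 4 * G.α / (μ 0 - μ l) ^ 2 ≤ C
  const_nonneg : 0 ≤ C
  long : ∀ i j, s ≤ phaseStart (G.phaseEnd i) j →
    K * (C * Real.log (G.phaseEnd i j) + 1) + phaseStart (G.phaseEnd i) j < G.phaseEnd i j

lemma zero_mem_active_of_received {G : Run N K} {t : ℕ} {i : Fin N}
    (he : t + 1 = G.phaseEnd i (G.state t i).phase) (hr : G.received t i = 0) :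
    0 ∈ (G.state (t + 1) i).active := by
  rw [G.state_succ_of_eq he, hr]
  exact AgentState.mem_nextPhase_active _ _ _ _

namespace IsAccurate

variable {G : Run N K} {μ : Fin K → ℝ} {A : ℕ → ℕ} {M : ℕ} {C : ℝ} {s : ℕ}

/-- If the best arm is available, then a suboptimal arm is pulled only as long as twice its
confidence radius is at least its gap. -/
lemma pulls_le_of_arm (h : G.IsAccurate μ A M C s) {t : ℕ} (ht : s ≤ t) {i : Fin N}
    (h0 : 0 ∈ (G.state t i).active) {l : Fin K} (hl : l ≠ 0) (harm : G.arm t i = l) :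
    ((G.state t i).pulls l : ℝ) ≤ 4 * G.α / (μ 0 - μ l) ^ 2 * Real.log (t + 1) := by
  have hgap : 0 < μ 0 - μ l := sub_pos.2 (h.bandit.best_unique l hl)
  have hlog : 0 ≤ Real.log ((t : ℝ) + 1) := Real.log_nonneg (by linarith [t.cast_nonneg (α := ℝ)])
  have hC : 0 ≤ 4 * G.α / (μ 0 - μ l) ^ 2 := by have := h.alpha_pos; positivity
  rcases Nat.eq_zero_or_pos ((G.state t i).pulls l) with hz | hpos
  · rw [hz]; simp only [Nat.cast_zero]; exact mul_nonneg hC hlog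
  have hmax := (mem_argmaxSet.1 (G.arm_mem_argmaxSet t i)).2 0 h0
  rw [harm] at hmax
  set n := (G.state t i).pulls l with hn
  set n₀ := (G.state t i).pulls 0 with hn₀
  have h1 : ucbIndex G.α (G.Y i) (t + 1) (G.state t i).pulls l =
      ((empMean (G.Y i l) n + √(G.α * Real.log (t + 1 : ℕ) / n) : ℝ) : EReal) := by
    rw [ucbIndex, if_neg (by omega)]
  rw [h1] at hmax
  have hz0 : 0 < n₀ := by
    by_contra hcon
    rw [ucbIndex, if_pos (by omega)] at hmax
    exact absurd hmax (not_le.2 (EReal.coe_lt_top _))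
  rw [ucbIndex, if_neg (by omega)] at hmax
  have hmax := EReal.coe_le_coe_iff.1 hmax
  have ha := abs_le.1
    (h.accurate (t + 1) (by omega) i l n hpos ((G.pulls_le t i l).trans (by omega)))
  have hb := abs_le.1
    (h.accurate (t + 1) (by omega) i 0 n₀ hz0 ((G.pulls_le t i 0).trans (by omega)))
  set r := √(G.α * Real.log (t + 1 : ℕ) / n) with hr
  have hle : μ 0 - μ l ≤ 2 * r := by linarith [ha.2, hb.1]
  have hr0 : r ^ 2 = G.α * Real.log (t + 1) / n := by
    rw [hr, Real.sq_sqrt]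
    · push_cast; rfl
    · push_cast
      have := h.alpha_pos
      positivity
  have hsq : (μ 0 - μ l) ^ 2 ≤ 4 * (G.α * Real.log (t + 1) / n) := by
    rw [← hr0]
    nlinarith [Real.sqrt_nonneg (G.α * Real.log (t + 1 : ℕ) / n)]
  have hnpos : (0 : ℝ) < n := by exact_mod_cast hpos
  rw [div_mul_eq_mul_div, le_div_iff₀ (by positivity)]
  calc (n : ℝ) * (μ 0 - μ l) ^ 2 ≤ n * (4 * (G.α * Real.log (t + 1) / n)) := by gcongr
    _ = _ := by field_simp

lemma bound_mono (h : G.IsAccurate μ A M C s) {t u : ℕ} (htu : t ≤ u) :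
    C * Real.log (t + 1) + 1 ≤ C * Real.log (u + 1) + 1 := by
  have h1 : (t : ℝ) ≤ u := by exact_mod_cast htu
  have h2 : Real.log ((t : ℝ) + 1) ≤ Real.log (u + 1) :=
    Real.log_le_log (by positivity) (by linarith)
  nlinarith [h.const_nonneg]

lemma played_phasePulls_le_of (h : G.IsAccurate μ A M C s) {t : ℕ} (ht : s ≤ t) {i : Fin N}
    (h0 : 0 ∈ (G.state t i).active) {l : Fin K} (hl : l ≠ 0)
    (hold : ((G.state t i).phasePulls l : ℝ) ≤ C * Real.log (t + 1) + 1) :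
    ((G.played t i).phasePulls l : ℝ) ≤ C * Real.log (t + 1) + 1 := by
  rw [played_phasePulls]
  by_cases harm : G.arm t i = l
  · have h1 := h.pulls_le_of_arm ht h0 hl harm
    have h2 : ((G.state t i).phasePulls l : ℝ) ≤ (G.state t i).pulls l := by
      exact_mod_cast G.phasePulls_le_pulls t i l
    have hlog : 0 ≤ Real.log ((t : ℝ) + 1) :=
      Real.log_nonneg (by linarith [t.cast_nonneg (α := ℝ)])
    have h3 := mul_le_mul_of_nonneg_right (h.le_const l hl) hlog
    simp only [harm, if_true]
    push_cast
    linarith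
  · simpa [harm] using hold

/-- Within a phase that starts on the concentration event with the best arm available, suboptimal
arms are pulled at most logarithmically often. -/
lemma phasePulls_le (h : G.IsAccurate μ A M C s) (t : ℕ) {i : Fin N}
    (hs : s ≤ phaseStart (G.phaseEnd i) (G.state t i).phase)
    (h0 : 0 ∈ (G.state t i).active) {l : Fin K} (hl : l ≠ 0) :
    ((G.state t i).phasePulls l : ℝ) ≤ C * Real.log (t + 1) + 1 := by
  have hnn : ∀ u : ℕ, 0 ≤ C * Real.log ((u : ℝ) + 1) + 1 := fun u => by
    have := mul_nonneg h.const_nonneg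
      (Real.log_nonneg (by linarith [u.cast_nonneg (α := ℝ)] : (1 : ℝ) ≤ (u : ℝ) + 1))
    linarith
  induction t with
  | zero => simp [state_zero, initState]
  | succ t ih =>
    by_cases he : t + 1 = G.phaseEnd i (G.state t i).phase
    · rw [G.state_succ_of_eq he, AgentState.nextPhase_phasePulls]
      simpa using hnn (t + 1)
    · rw [G.state_succ_of_ne he] at hs h0 ⊢
      have hst : s ≤ t := hs.trans (phase_spec h.schedule h.timetable t i).1
      exact (h.played_phasePulls_le_of hst h0 hl (ih hs h0)).trans (h.bound_mono (Nat.le_succ t))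

/-- At the end of a long phase, the best arm is the only one that was played most. -/
lemma played_phasePulls_lt (h : G.IsAccurate μ A M C s) {t : ℕ} {i : Fin N}
    (he : t + 1 = G.phaseEnd i (G.state t i).phase)
    (hs : s ≤ phaseStart (G.phaseEnd i) (G.state t i).phase)
    (h0 : 0 ∈ (G.state t i).active) {l : Fin K} (hl : l ≠ 0) :
    (G.played t i).phasePulls l < (G.played t i).phasePulls 0 := by
  have hst : s ≤ t := hs.trans (phase_spec h.schedule h.timetable t i).1
  have hb : ∀ l, l ≠ 0 → ((G.played t i).phasePulls l : ℝ) ≤ C * Real.log (t + 1) + 1 :=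
    fun l hl => h.played_phasePulls_le_of hst h0 hl (h.phasePulls_le t hs h0 hl)
  have hsum : phaseStart (G.phaseEnd i) (G.state t i).phase + ∑ l, (G.played t i).phasePulls l =
      t + 1 := by
    have := sum_phasePulls (G := G) t i
    simp only [played_phasePulls, Finset.sum_add_distrib, Finset.sum_ite_eq, Finset.mem_univ,
      if_true]
    omega
  have hlong := h.long i _ hs
  rw [← he] at hlong
  push_cast at hlong
  rw [← Finset.add_sum_erase _ _ (Finset.mem_univ (0 : Fin K))] at hsum
  have hrest : ∑ l ∈ Finset.univ.erase (0 : Fin K), ((G.played t i).phasePulls l : ℝ) ≤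
      (K - 1) * (C * Real.log (t + 1) + 1) := by
    refine (Finset.sum_le_card_nsmul _ _ _ fun l hl => hb l (Finset.ne_of_mem_erase hl)).trans ?_
    rw [Finset.card_erase_of_mem (Finset.mem_univ _), Finset.card_univ, Fintype.card_fin,
      nsmul_eq_mul, Nat.cast_pred (Nat.pos_of_ne_zero (NeZero.ne K))]
  have hsum' : (phaseStart (G.phaseEnd i) (G.state t i).phase : ℝ) +
      ((G.played t i).phasePulls 0 +
        ∑ l ∈ Finset.univ.erase (0 : Fin K), ((G.played t i).phasePulls l : ℝ)) = t + 1 := by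
    exact_mod_cast hsum
  have hbl := hb l hl
  have : ((G.played t i).phasePulls l : ℝ) < (G.played t i).phasePulls 0 := by linarith
  exact_mod_cast this

lemma zero_mem_active_succ (h : G.IsAccurate μ A M C s) {t : ℕ} {i : Fin N}
    (hs : s ≤ phaseStart (G.phaseEnd i) (G.state t i).phase)
    (h0 : 0 ∈ (G.state t i).active) : 0 ∈ (G.state (t + 1) i).active := by
  by_cases he : t + 1 = G.phaseEnd i (G.state t i).phase
  · rw [G.state_succ_of_eq he]
    unfold AgentState.nextPhase
    split
    · exact h0
    · rw [G.active_eq] at h0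
      rcases Finset.mem_union.1 h0 with h1 | h1
      · exact Finset.mem_union_left _ h1
      · have hmax : argmaxSet {(G.played t i).U, (G.played t i).L} (G.played t i).phasePulls = {0} :=
          argmaxSet_eq_singleton h1 fun l hl =>
            h.played_phasePulls_lt he hs (by rw [G.active_eq]; exact h0) hl
        have hk := G.tie.keep_mem i (t + 1) {0} (Finset.singleton_nonempty _)
        rw [Finset.mem_singleton] at hk
        simp [hmax, hk]
  · rw [G.state_succ_of_ne he]
    exact h0

lemma phaseStart_succ_le (h : G.IsAccurate μ A M C s) (t : ℕ) (i : Fin N) :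
    phaseStart (G.phaseEnd i) (G.state t i).phase ≤
      phaseStart (G.phaseEnd i) (G.state (t + 1) i).phase := by
  apply phaseStart_mono ((h.timetable i).strictMono h.schedule)
  by_cases he : t + 1 = G.phaseEnd i (G.state t i).phase
  · rw [G.state_succ_of_eq he, AgentState.nextPhase_phase]
    exact Nat.le_succ _
  · rw [G.state_succ_of_ne he]
    exact le_rfl

/-- An agent that has the best arm at the start of a long phase never discards it. -/
lemma zero_mem_active_of_le (h : G.IsAccurate μ A M C s) {t : ℕ} {i : Fin N}
    (hs : s ≤ phaseStart (G.phaseEnd i) (G.state t i).phase)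
    (h0 : 0 ∈ (G.state t i).active) {u : ℕ} (hu : t ≤ u) : 0 ∈ (G.state u i).active := by
  suffices s ≤ phaseStart (G.phaseEnd i) (G.state u i).phase ∧ 0 ∈ (G.state u i).active from this.2
  induction u, hu using Nat.le_induction with
  | base => exact ⟨hs, h0⟩
  | succ u _ ih => exact ⟨ih.1.trans (h.phaseStart_succ_le u i), h.zero_mem_active_succ ih.1 ih.2⟩

/-! ### Recommendations -/

lemma prevPulls_lt (h : G.IsAccurate μ A M C s) {τ : ℕ} (hτ : s ≤ τ) {i : Fin N}
    (hinf : ∀ t, τ ≤ t → 0 ∈ (G.state t i).active) (t j : ℕ)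
    (hj : (G.state t i).phase = j + 1) (hs : τ ≤ phaseStart (G.phaseEnd i) j) :
    0 ∈ (G.state t i).prevActive ∧
      ∀ l, l ≠ 0 → (G.state t i).prevPulls l < (G.state t i).prevPulls 0 := by
  induction t with
  | zero => simp [state_zero, initState] at hj
  | succ t ih =>
    by_cases he : t + 1 = G.phaseEnd i (G.state t i).phase
    · rw [G.state_succ_of_eq he, AgentState.nextPhase_phase] at hj
      have hj' : (G.state t i).phase = j := Nat.succ_injective hj
      rw [G.state_succ_of_eq he, AgentState.nextPhase_prevActive, AgentState.nextPhase_prevPulls]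
      have h1 := (phase_spec h.schedule h.timetable t i).1
      rw [← hj'] at hs
      have h0 := hinf t (hs.trans h1)
      exact ⟨h0, fun l hl => h.played_phasePulls_lt he (hτ.trans hs) h0 hl⟩
    · rw [G.state_succ_of_ne he] at hj ⊢
      exact ih hj

/-- A contacted agent recommends the best arm if it had this arm throughout the current and the
previous phase. -/
lemma received_eq (h : G.IsAccurate μ A M C s) {τ : ℕ} (hτ : s ≤ τ) {t j : ℕ} {i m : Fin N}
    (he : t + 1 = G.phaseEnd i (G.state t i).phase) (hm : G.Z i (G.state t i).phase = m)
    (hinf : ∀ t, τ ≤ t → 0 ∈ (G.state t m).active)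
    (hj : (G.state t m).phase = j + 1) (hs : τ ≤ phaseStart (G.phaseEnd m) j) :
    G.received t i = 0 := by
  have key : G.advice (G.played t m) = {0} := by
    rcases h.advice with ⟨ha, hsync⟩ | ha
    · rw [ha]
      have hsm := (h.timetable m).strictMono h.schedule
      have hjs : phaseStart (G.phaseEnd m) j ≤ phaseStart (G.phaseEnd m) (j + 1) :=
        phaseStart_mono hsm (Nat.le_succ j)
      have h1 := (phase_spec h.schedule h.timetable t m)
      have h2 := (phase_spec h.schedule h.timetable t i)
      have hpm : (G.state t i).phase = (G.state t m).phase := by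
        refine le_antisymm (phase_le_of_start_le h.schedule h.timetable ?_)
          (phase_le_of_start_le h.schedule h.timetable ?_)
        · rw [hsync i m]; exact h1.2
        · rw [hsync m i]; exact h2.2
      have he' : t + 1 = G.phaseEnd m (G.state t m).phase := by rw [he, hpm, hsync i m]
      have h0 : 0 ∈ (G.state t m).active := by
        apply hinf
        rw [hj] at h1
        omega
      exact argmaxSet_eq_singleton h0 fun l hl => h.played_phasePulls_lt he' (by rw [hj]; omega) h0 hl
    · rw [ha]
      have := h.prevPulls_lt hτ hinf t j hj hs
      exact argmaxSet_eq_singleton this.1 this.2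
  have hr := G.tie.recommend_mem m (t + 1) {0} (Finset.singleton_nonempty _)
  rw [Finset.mem_singleton] at hr
  rw [received, hm, key, hr]

/-! ### The spread of the best arm -/

/-- Two phases after slot `A a`, both the current and the previous phase of an agent started after
`A a`. -/
lemma exists_previous_phase (h : G.IsAccurate μ A M C s) (m : Fin N) {a t : ℕ}
    (ht : A (a + (M + 1) * 2) ≤ t) :
    ∃ j, (G.state t m).phase = j + 1 ∧ A a ≤ phaseStart (G.phaseEnd m) j := by
  have hq := phase_spec h.schedule h.timetable (A a) m
  have h1 := (h.timetable m).end_le_schedule h.schedule hq.1 1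
  have h2 := lt_phase_of_end_le h.schedule h.timetable (h1.trans ht)
  refine ⟨(G.state t m).phase - 1, by omega, ?_⟩
  refine hq.2.le.trans (phaseStart_mono ((h.timetable m).strictMono h.schedule)
    (?_ : (G.state (A a) m).phase + 1 ≤ _))
  omega

/-- One round of spreading: agent `m` has the best arm since slot `A a`, and agent `i` contacts it in
every window of `L + 1` phases that starts with a phase of number at most `k₀`. The two extra phases
make sure that the recommendation of `m` refers to a phase that started after `A a`. -/
lemma spread_step (h : G.IsAccurate μ A M C s) {a L k₀ : ℕ} (ha : s ≤ A a) {i m : Fin N}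
    (hinf : ∀ t, A a ≤ t → 0 ∈ (G.state t m).active)
    (hZ : ∀ k ≤ k₀, ∃ j, k ≤ j ∧ j < k + (L + 1) ∧ G.Z i j = m)
    (hk : a + (M + 1) * 2 + 1 ≤ k₀) {t : ℕ} (ht : A (a + (M + 1) * (L + 3)) ≤ t) :
    0 ∈ (G.state t i).active := by
  set a₁ := a + (M + 1) * 2 with ha₁
  have hq := phase_spec h.schedule h.timetable (A a₁) i
  set q := (G.state (A a₁) i).phase with hqdef
  have hqk : q ≤ k₀ := by
    refine (phase_le_of_start_le h.schedule h.timetable (j := a₁ + 1) ?_).trans (by omega)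
    exact lt_of_lt_of_le (h.schedule.strictMono (Nat.lt_succ_self _))
      ((h.timetable i).schedule_le h.schedule (a₁ + 1))
  obtain ⟨j, hkj, hjL, hZj⟩ := hZ q hqk
  have hsm := (h.timetable i).strictMono h.schedule
  -- The slot before the communication at the end of phase `j`.
  obtain ⟨u, hu⟩ : ∃ u, u + 1 = G.phaseEnd i j :=
    ⟨G.phaseEnd i j - 1, Nat.sub_add_cancel
      (lt_of_le_of_lt (Nat.zero_le _) (hq.2.trans_le (hsm.monotone hkj)))⟩
  have hua : A a₁ ≤ u := by
    have := hq.2.trans_le (hsm.monotone hkj)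
    omega
  have hphase : (G.state u i).phase = j := by
    refine le_antisymm (phase_le_of_start_le h.schedule h.timetable (by omega)) ?_
    have h2 := (phase_spec h.schedule h.timetable u i).2
    have h3 : G.phaseEnd i j ≤ G.phaseEnd i (G.state u i).phase := by omega
    exact hsm.le_iff_le.1 h3
  obtain ⟨r, hr, hrs⟩ := h.exists_previous_phase m (ha₁ ▸ hua)
  have he : u + 1 = G.phaseEnd i (G.state u i).phase := by rw [hphase, hu]
  have hrec := h.received_eq ha he (by rw [hphase]; exact hZj) hinf hr hrs
  have h0 := zero_mem_active_of_received he hrec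
  refine h.zero_mem_active_of_le (t := u + 1) ?_ h0 ?_
  · rw [G.state_succ_of_eq he, AgentState.nextPhase_phase]
    change s ≤ G.phaseEnd i (G.state u i).phase
    rw [← he]
    have : A a ≤ A a₁ := h.schedule.strictMono.monotone (by omega)
    omega
  · have h1 := (h.timetable i).end_le_schedule h.schedule hq.1 L
    have h2 : a₁ + (M + 1) * (L + 1) = a + (M + 1) * (L + 3) := by rw [ha₁]; ring
    rw [h2] at h1
    have h3 : G.phaseEnd i j ≤ G.phaseEnd i (q + L) := hsm.monotone (by omega)
    omega

/-- Once all agents have the best arm and keep recommending it, the playing sets are frozen. -/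
lemma active_eq_of_le (h : G.IsAccurate μ A M C s) {a : ℕ} (ha : s ≤ A a)
    (hinf : ∀ i t, A a ≤ t → 0 ∈ (G.state t i).active) (i : Fin N) {t : ℕ}
    (ht : A (a + (M + 1) * 2) ≤ t) :
    (G.state t i).active = (G.state (A (a + (M + 1) * 2)) i).active := by
  have hmono : A a ≤ A (a + (M + 1) * 2) := h.schedule.strictMono.monotone (by omega)
  induction t, ht using Nat.le_induction with
  | base => rfl
  | succ t ht ih =>
    rw [← ih]
    by_cases he : t + 1 = G.phaseEnd i (G.state t i).phase
    · obtain ⟨r, hr, hrs⟩ := h.exists_previous_phase (G.Z i (G.state t i).phase) ht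
      have hrec := h.received_eq ha he rfl (hinf _) hr hrs
      rw [G.state_succ_of_eq he, hrec]
      exact AgentState.nextPhase_active_of_mem _ _ _ (hinf i t (hmono.trans ht))
    · rw [G.state_succ_of_ne he]
      rfl

end IsAccurate
end Run
/-! ### The regret of a run in which the best arm spreads -/

/-- The `n` smallest indices carry the largest values of an antitone function. -/
lemma sum_le_sum_filter_of_antitone {K n : ℕ} [NeZero K] {f : Fin K → ℝ}
    (hf0 : ∀ l, l ≠ 0 → 0 ≤ f l)
    (hf : ∀ l m, l ≠ 0 → l ≤ m → f m ≤ f l) {S : Finset (Fin K)} (hS0 : 0 ∉ S) (hS : S.card ≤ n) :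
    ∑ l ∈ S, f l ≤ ∑ l : Fin K with 1 ≤ l.val ∧ l.val ≤ n, f l := by
  classical
  have hne : ∀ l : Fin K, l ≠ 0 ↔ 1 ≤ l.val := fun l => by
    rw [Nat.one_le_iff_ne_zero, ne_eq, ne_eq, Fin.ext_iff, Fin.val_zero]
  set R : Finset (Fin K) := Finset.univ.filter fun l : Fin K => 1 ≤ l.val ∧ l.val ≤ n with hR
  have hRmem : ∀ l, l ∈ R ↔ l ≠ 0 ∧ l.val ≤ n := fun l => by simp [hR, hne]
  rcases Nat.lt_or_ge n K with hn | hn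
  · -- Both sides are compared with multiples of the value at index `n`.
    rcases Nat.eq_zero_or_pos n with rfl | hpos
    · rw [Finset.card_eq_zero.1 (Nat.le_zero.1 hS), Finset.sum_empty]
      exact Finset.sum_nonneg fun l hl => hf0 l ((hRmem l).1 hl).1
    set b : Fin K := ⟨n, hn⟩
    have hb0 : b ≠ 0 := (hne b).2 hpos
    have hRcard : R.card = n := by
      have : R.map Fin.valEmbedding = Finset.Icc 1 n := by
        ext x
        simp only [Finset.mem_map, Fin.valEmbedding_apply, Finset.mem_Icc]
        constructor
        · rintro ⟨l, hl, rfl⟩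
          exact (Finset.mem_filter.1 hl).2
        · intro hx
          exact ⟨⟨x, by omega⟩, Finset.mem_filter.2 ⟨Finset.mem_univ _, hx⟩, rfl⟩
      rw [← Finset.card_map Fin.valEmbedding, this]
      simp
    have h1 : ∑ l ∈ S \ R, f l ≤ (S \ R).card • f b := by
      refine Finset.sum_le_card_nsmul _ _ _ fun l hl => ?_
      rw [Finset.mem_sdiff, hRmem] at hl
      have hl0 : l ≠ 0 := fun h => hS0 (h ▸ hl.1)
      refine hf b l hb0 ?_
      have : ¬ l.val ≤ n := fun h => hl.2 ⟨hl0, h⟩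
      exact Fin.le_def.2 (not_le.1 this).le
    have h2 : (R \ S).card • f b ≤ ∑ l ∈ R \ S, f l := by
      refine Finset.card_nsmul_le_sum _ _ _ fun l hl => ?_
      rw [Finset.mem_sdiff, hRmem] at hl
      exact hf l b hl.1.1 (Fin.le_def.2 hl.1.2)
    have h3 : (S \ R).card ≤ (R \ S).card := by
      have e1 := Finset.card_sdiff_add_card_inter S R
      have e2 := Finset.card_sdiff_add_card_inter R S
      rw [Finset.inter_comm] at e2
      omega
    have h4 : (S \ R).card • f b ≤ (R \ S).card • f b := nsmul_le_nsmul_left (hf0 b hb0) h3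
    rw [← Finset.sum_inter_add_sum_sdiff S R, ← Finset.sum_inter_add_sum_sdiff R S,
      Finset.inter_comm R S]
    linarith
  · refine Finset.sum_le_sum_of_subset_of_nonneg (fun l hl => ?_)
      fun l hl _ => hf0 l ((hRmem l).1 hl).1
    exact (hRmem l).2 ⟨fun h => hS0 (h ▸ hl), by omega⟩

namespace Run

variable {N K : ℕ} [NeZero K]

lemma zero_mem_sticky (N K : ℕ) [NeZero K] {i : Fin N} (hi : i.val = 0) : 0 ∈ sticky N K i := by
  refine Finset.mem_image.2 ⟨0, ?_, ?_⟩
  · have hN : 0 < N := i.pos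
    rw [Finset.mem_range, Nat.ceilDiv_eq_add_pred_div]
    have hK : 0 < K := Nat.pos_of_ne_zero (NeZero.ne K)
    exact Nat.div_pos (by omega) hN
  · simp [hi]

namespace IsAccurate

variable {G : Run N K} {μ : Fin K → ℝ} {A : ℕ → ℕ} {M : ℕ} {C : ℝ} {s : ℕ}

/-- The best arm spreads backwards along the paths of positive probability to an agent for which
it is sticky. -/
lemma spread_path (h : G.IsAccurate μ A M C s) {P : Matrix (Fin N) (Fin N) ℝ}
    (hP : ∀ i m, 0 ≤ P i m) {l L k₀ : ℕ} (hl : s ≤ A l)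
    (hZ : ∀ i m, 0 < P i m → ∀ k ≤ k₀, ∃ j, k ≤ j ∧ j < k + (L + 1) ∧ G.Z i j = m)
    {i₀ : Fin N} (hi₀ : 0 ∈ sticky N K i₀) (w : ℕ)
    (hk : l + (M + 1) * (L + 3) * w + 1 ≤ k₀) (i : Fin N) (hw : 0 < (P ^ w) i i₀) {t : ℕ}
    (ht : A (l + (M + 1) * (L + 3) * w) ≤ t) : 0 ∈ (G.state t i).active := by
  induction w generalizing i t with
  | zero =>
    have : i = i₀ := by
      by_contra hne
      simp [Matrix.one_apply_ne hne] at hw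
    rw [G.active_eq, this]
    exact Finset.mem_union_left _ hi₀
  | succ w ih =>
    have hstep : (M + 1) * (L + 3) * (w + 1) = (M + 1) * (L + 3) * w + (M + 1) * (L + 3) := by ring
    have h2 : (M + 1) * 2 ≤ (M + 1) * (L + 3) := Nat.mul_le_mul_left _ (by omega)
    rw [pow_succ', Matrix.mul_apply] at hw
    obtain ⟨m, -, hm⟩ := Finset.exists_lt_of_sum_lt (s := Finset.univ) (f := fun _ => (0 : ℝ))
      (by simpa using hw)
    have hPm : 0 < P i m := (hP i m).lt_of_ne fun h0 => by simp [← h0] at hm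
    have hPw : 0 < (P ^ w) m i₀ := (pos_iff_pos_of_mul_pos hm).1 hPm
    refine h.spread_step (a := l + (M + 1) * (L + 3) * w) ?_
      (fun t ht => ih (by omega) m hPw ht) (hZ i m hPm) (by omega) ?_
    · exact hl.trans (h.schedule.strictMono.monotone (by omega))
    · rw [hstep] at ht
      rwa [add_assoc]

lemma count_le (h : G.IsAccurate μ A M C s) {F : ℕ} (hF : s ≤ F) {i : Fin N}
    (hinf : ∀ t, F ≤ t → 0 ∈ (G.state t i).active) {l : Fin K} (hl : l ≠ 0) (T : ℕ) :
    (((Finset.range T).filter fun t => F ≤ t ∧ G.arm t i = l).card : ℝ) ≤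
      4 * G.α / (μ 0 - μ l) ^ 2 * Real.log T + 1 := by
  have hC : 0 ≤ 4 * G.α / (μ 0 - μ l) ^ 2 := by have := h.alpha_pos; positivity
  induction T with
  | zero => simp
  | succ T ih =>
    by_cases harm : F ≤ T ∧ G.arm T i = l
    · have h1 := h.pulls_le_of_arm (hF.trans harm.1) (hinf T harm.1) hl harm.2
      have h2 : ((Finset.range (T + 1)).filter fun t => F ≤ t ∧ G.arm t i = l).card ≤
          (G.state T i).pulls l + 1 := by
        have := G.pulls_succ T i l
        rw [if_pos harm.2] at this
        rw [← this, G.pulls_eq_card]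
        exact Finset.card_le_card (Finset.monotone_filter_right _ fun t _ ht => ht.2)
      have h3 : (((Finset.range (T + 1)).filter fun t => F ≤ t ∧ G.arm t i = l).card : ℝ) ≤
          (G.state T i).pulls l + 1 := by exact_mod_cast h2
      push_cast
      linarith
    · rw [Finset.range_add_one, Finset.filter_insert, if_neg harm]
      refine ih.trans ?_
      have : Real.log T ≤ Real.log (T + 1 : ℕ) := by
        rcases Nat.eq_zero_or_pos T with rfl | hT
        · simp
        · exact Real.log_le_log (by exact_mod_cast hT) (by push_cast; linarith)
      gcongr

/-- After the playing sets are frozen, every suboptimal arm of the playing set contributes as in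
the analysis of the UCB algorithm, and a playing set has at most `⌈K / N⌉ + 1` suboptimal arms. -/
lemma regret_le_of_frozen (h : G.IsAccurate μ A M C s) {F : ℕ} (hF : s ≤ F) {i : Fin N}
    (hinf : ∀ t, F ≤ t → 0 ∈ (G.state t i).active)
    (hfr : ∀ t, F ≤ t → (G.state t i).active = (G.state F i).active) (T : ℕ) :
    ∑ t ∈ Finset.range T, (μ 0 - μ (G.arm t i)) ≤
      F + K + (∑ l : Fin K with 1 ≤ l.val ∧ l.val ≤ K ⌈/⌉ N + 1, 4 * G.α / (μ 0 - μ l)) *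
        Real.log T := by
  have hα := h.alpha_pos
  have hΔ : ∀ l, l ≠ 0 → 0 < μ 0 - μ l := fun l hl => sub_pos.2 (h.bandit.best_unique l hl)
  have hΔ0 : ∀ l, 0 ≤ μ 0 - μ l := fun l => sub_nonneg.2 (h.bandit.antitone (Fin.zero_le l))
  have hΔ1 : ∀ l, μ 0 - μ l ≤ 1 := fun l => by linarith [h.bandit.lt_one, h.bandit.nonneg l]
  have hlog : 0 ≤ Real.log T := Real.log_natCast_nonneg T
  set S := (G.state F i).active with hS
  rw [← Finset.sum_filter_add_sum_filter_not (Finset.range T) (fun t => t < F)]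
  have h1 : ∑ t ∈ (Finset.range T).filter (fun t => t < F), (μ 0 - μ (G.arm t i)) ≤ F := by
    refine (Finset.sum_le_card_nsmul _ _ 1 fun t _ => hΔ1 _).trans ?_
    rw [nsmul_eq_mul, mul_one]
    have : ((Finset.range T).filter (fun t => t < F)).card ≤ (Finset.range F).card :=
      Finset.card_le_card fun t ht => by simp at ht ⊢; exact ht.2
    rw [Finset.card_range] at this
    exact_mod_cast this
  have h2 : ∑ t ∈ (Finset.range T).filter (fun t => ¬ t < F), (μ 0 - μ (G.arm t i)) =
      ∑ l ∈ S.erase 0, (μ 0 - μ l) *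
        ((Finset.range T).filter fun t => F ≤ t ∧ G.arm t i = l).card := by
    have hmaps : ∀ t ∈ (Finset.range T).filter (fun t => ¬ t < F), G.arm t i ∈ S := fun t ht => by
      rw [← hfr t (not_lt.1 (Finset.mem_filter.1 ht).2)]
      exact G.arm_mem_active t i
    rw [← Finset.sum_fiberwise_of_maps_to hmaps,
      ← Finset.add_sum_erase S _ (hinf F le_rfl)]
    have hz : ∑ t ∈ ((Finset.range T).filter (fun t => ¬ t < F)).filter (fun t => G.arm t i = 0),
        (μ 0 - μ (G.arm t i)) = 0 :=
      Finset.sum_eq_zero fun t ht => by rw [(Finset.mem_filter.1 ht).2, sub_self]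
    rw [hz, zero_add]
    refine Finset.sum_congr rfl fun l _ => ?_
    rw [Finset.filter_filter]
    simp only [not_lt]
    rw [Finset.sum_congr rfl (g := fun _ => μ 0 - μ l)
      fun t ht => by rw [(Finset.mem_filter.1 ht).2.2], Finset.sum_const, nsmul_eq_mul, mul_comm]
  have h3 : ∑ l ∈ S.erase 0, (μ 0 - μ l) *
        (((Finset.range T).filter fun t => F ≤ t ∧ G.arm t i = l).card : ℝ) ≤
      ∑ l ∈ S.erase 0, (4 * G.α / (μ 0 - μ l) * Real.log T + 1) := by
    refine Finset.sum_le_sum fun l hl => ?_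
    have hl0 := Finset.ne_of_mem_erase hl
    have hd := hΔ l hl0
    calc _ ≤ (μ 0 - μ l) * (4 * G.α / (μ 0 - μ l) ^ 2 * Real.log T + 1) := by
          gcongr
          exact h.count_le hF hinf hl0 T
      _ = 4 * G.α / (μ 0 - μ l) * Real.log T + (μ 0 - μ l) := by
          field_simp
      _ ≤ _ := by linarith [hΔ1 l]
  have h4 : ∑ l ∈ S.erase 0, 4 * G.α / (μ 0 - μ l) ≤
      ∑ l : Fin K with 1 ≤ l.val ∧ l.val ≤ K ⌈/⌉ N + 1, 4 * G.α / (μ 0 - μ l) := by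
    refine sum_le_sum_filter_of_antitone (fun l hl => ?_) (fun l m hl hlm => ?_)
      (Finset.notMem_erase 0 S) ?_
    · have := hΔ l hl; positivity
    · have := hΔ l hl
      have := h.bandit.antitone hlm
      gcongr
    · rw [Finset.card_erase_of_mem (hinf F le_rfl)]
      have := G.card_active_le F i
      omega
  have h5 : ((S.erase 0).card : ℝ) ≤ K := by
    have : (S.erase 0).card ≤ K := (Finset.card_le_univ _).trans (by simp)
    exact_mod_cast this
  rw [Finset.sum_add_distrib, ← Finset.sum_mul, Finset.sum_const, nsmul_eq_mul, mul_one] at h3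
  rw [h2]
  have h6 := mul_le_mul_of_nonneg_right h4 hlog
  linarith

/-- If all windows of `L + 1` phases contain all possible contacts, then `H` rounds of spreading,
where `H` bounds the length of the paths to an agent for which the best arm is sticky, freeze the
playing sets by slot `A (2 * l)`. -/
lemma regret_le (h : G.IsAccurate μ A M C s) {P : Matrix (Fin N) (Fin N) ℝ}
    (hP : ∀ i m, 0 ≤ P i m) {l L H : ℕ} (hl : s ≤ A l)
    (hZ : ∀ i m, 0 < P i m → ∀ k ≤ 2 * l, ∃ j, k ≤ j ∧ j < k + (L + 1) ∧ G.Z i j = m)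
    {i₀ : Fin N} (hi₀ : 0 ∈ sticky N K i₀) (hH : ∀ i, ∃ w ≤ H, 0 < (P ^ w) i i₀)
    (hL : (M + 1) * (L + 3) * (H + 1) + 1 ≤ l) (i : Fin N) (T : ℕ) :
    ∑ t ∈ Finset.range T, (μ 0 - μ (G.arm t i)) ≤
      A (2 * l) + K + (∑ l : Fin K with 1 ≤ l.val ∧ l.val ≤ K ⌈/⌉ N + 1, 4 * G.α / (μ 0 - μ l)) *
        Real.log T := by
  set a := l + (M + 1) * (L + 3) * H with ha
  have hstep : (M + 1) * (L + 3) * (H + 1) = (M + 1) * (L + 3) * H + (M + 1) * (L + 3) := by ring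
  have h2 : (M + 1) * 2 ≤ (M + 1) * (L + 3) := Nat.mul_le_mul_left _ (by omega)
  have hmono := h.schedule.strictMono.monotone
  have hinf : ∀ i t, A a ≤ t → 0 ∈ (G.state t i).active := fun i t ht => by
    obtain ⟨w, hw, hpos⟩ := hH i
    have hwH : (M + 1) * (L + 3) * w ≤ (M + 1) * (L + 3) * H := Nat.mul_le_mul_left _ hw
    exact h.spread_path hP hl hZ hi₀ w (by omega) i hpos ((hmono (by omega)).trans ht)
  have hsa : s ≤ A a := hl.trans (hmono (by omega))
  have hle : A (a + (M + 1) * 2) ≤ A (2 * l) := hmono (by omega)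
  have haa : A a ≤ A (a + (M + 1) * 2) := hmono (by omega)
  have := h.regret_le_of_frozen (hsa.trans haa) (i := i) (fun t ht => hinf i t (haa.trans ht))
    (fun t ht => h.active_eq_of_le hsa hinf i ht) T
  have hcast : (A (a + (M + 1) * 2) : ℝ) ≤ A (2 * l) := by exact_mod_cast hle
  linarith

end IsAccurate
end Run
/-! ### Measurability of the regret -/

section Measurability

instance {K : ℕ} : MeasurableSpace (AgentState K) := ⊤

instance {K : ℕ} : DiscreteMeasurableSpace (AgentState K) := ⟨fun _ => trivial⟩

instance {K : ℕ} : Countable (AgentState K) := by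
  let f : AgentState K → ℕ × Finset (Fin K) × Fin K × Fin K × (Fin K → ℕ) × (Fin K → ℕ) ×
      Finset (Fin K) × (Fin K → ℕ) := fun s =>
    (s.phase, s.active, s.U, s.L, s.pulls, s.phasePulls, s.prevActive, s.prevPulls)
  refine Function.Injective.countable (f := f) fun s t h => ?_
  cases s
  cases t
  simpa [f] using h

variable {Ω C D : Type*} [MeasurableSpace Ω] [MeasurableSpace C] [MeasurableSpace D]

lemma measurable_apply_of_countable [Countable C] [MeasurableSingletonClass C] {f : Ω → C}
    (hf : Measurable f) {g : C → Ω → D} (hg : ∀ c, Measurable (g c)) :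
    Measurable fun ω => g (f ω) ω :=
  (measurable_from_prod_countable_right (f := fun p : C × Ω => g p.1 p.2) hg).comp
    (hf.prodMk measurable_id)

lemma measurableSet_argmaxSet {K : ℕ} {β : Type*} [LinearOrder β] [TopologicalSpace β]
    [OrderClosedTopology β] [MeasurableSpace β] [OpensMeasurableSpace β]
    [SecondCountableTopology β] (S R : Finset (Fin K)) {f : Ω → Fin K → β}
    (hf : ∀ l, Measurable fun ω => f ω l) : MeasurableSet {ω | argmaxSet S (f ω) = R} := by
  have : {ω | argmaxSet S (f ω) = R} =
      ⋂ l, {ω | (l ∈ S ∧ ∀ m ∈ S, f ω m ≤ f ω l) ↔ l ∈ R} := by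
    ext ω
    simp [Finset.ext_iff, mem_argmaxSet]
  rw [this]
  refine MeasurableSet.iInter fun l => ?_
  have h1 : Measurable fun ω => l ∈ S ∧ ∀ m ∈ S, f ω m ≤ f ω l :=
    measurable_const.and (Measurable.forall fun m =>
      measurable_const.imp (measurableSet_setOfPred.1 (measurableSet_le (hf m) (hf l))))
  exact measurableSet_setOfPred.2 (h1.iff measurable_const)

variable {N K : ℕ} {tie : Ω → TieBreak N K} {Y : Ω → Fin N → Fin K → ℕ → Bool}
  {Z : Ω → Fin N → ℕ → Fin N} {E : Ω → Fin N → ℕ → ℕ}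

lemma measurable_ucbIndex (hY : Measurable Y) (α : ℝ) (i : Fin N) (t : ℕ) (pulls : Fin K → ℕ)
    (l : Fin K) : Measurable fun ω => ucbIndex α (Y ω i) t pulls l := by
  unfold ucbIndex
  split
  · exact measurable_const
  · refine Measurable.coe_real_ereal (Measurable.add_const ?_ _)
    unfold empMean
    refine Measurable.div_const (Finset.measurable_sum _ fun s _ => ?_) _
    have : Measurable fun ω => Y ω i l s := by fun_prop
    exact (measurable_of_countable fun b : Bool => if b then (1 : ℝ) else 0).comp this

lemma measurable_nextPhase (st : AgentState K) (s : Finset (Fin K))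
    {keep : Ω → Finset (Fin K) → Fin K} {O : Ω → Fin K}
    (hkeep : ∀ R, Measurable fun ω => keep ω R) (hO : Measurable O) :
    Measurable fun ω => st.nextPhase s (keep ω) (O ω) := by
  have h1 : Measurable fun ω => keep ω (argmaxSet {st.U, st.L} st.phasePulls) := hkeep _
  have h2 : ∀ ω, st.nextPhase s (keep ω) (O ω) =
      st.nextPhase s (fun _ => keep ω (argmaxSet {st.U, st.L} st.phasePulls)) (O ω) := fun ω => rfl
  simp only [h2]
  exact (measurable_of_countable fun p : Fin K × Fin K => st.nextPhase s (fun _ => p.1) p.2).comp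
    (h1.prodMk hO)

lemma measurable_pulledArm (htie : MeasurableTies tie) (hY : Measurable Y) (α : ℝ) (t : ℕ)
    (st : Fin N → AgentState K) (i : Fin N) :
    Measurable fun ω => pulledArm α (tie ω) (Y ω) t st i := by
  let _ : MeasurableSpace (Finset (Fin K)) := ⊤
  have : Measurable fun ω => argmaxSet (st i).active (ucbIndex α (Y ω i) t (st i).pulls) :=
    measurable_to_countable' fun R =>
      measurableSet_argmaxSet _ R fun l => measurable_ucbIndex hY α i t _ l
  exact measurable_apply_of_countable this fun R => htie.pull i t R

variable [NeZero K]

lemma measurable_states (htie : MeasurableTies tie) (hY : Measurable Y) (hZ : Measurable Z)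
    (hE : ∀ i j, Measurable fun ω => E ω i j) (α : ℝ) (advice : AgentState K → Finset (Fin K))
    (t : ℕ) : Measurable fun ω => states α (tie ω) (Y ω) (Z ω) (E ω) advice t := by
  induction t with
  | zero => exact measurable_const
  | succ t ih =>
    refine measurable_apply_of_countable ih
      (g := fun st ω => step α (tie ω) (Y ω) (Z ω) (E ω) advice (t + 1) st) fun st => ?_
    refine measurable_pi_lambda _ fun i => ?_
    have harm : Measurable fun ω k => pulledArm α (tie ω) (Y ω) (t + 1) st k :=
      measurable_pi_lambda _ fun k => measurable_pulledArm htie hY α (t + 1) st k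
    have hZ' : Measurable fun ω => Z ω i (st i).phase := by fun_prop
    refine measurable_apply_of_countable (harm.prodMk (hZ'.prodMk (hE i (st i).phase)))
      (g := fun c ω => if t + 1 = c.2.2 then
        ((st i).play (c.1 i)).nextPhase (sticky N K i) ((tie ω).keep i (t + 1))
          ((tie ω).recommend c.2.1 (t + 1) (advice ((st c.2.1).play (c.1 c.2.1))))
        else (st i).play (c.1 i)) fun c => ?_
    split
    · exact measurable_nextPhase _ _ (fun R => htie.keep i _ R) (htie.recommend _ _ _)
    · exact measurable_const

lemma measurable_regret (htie : MeasurableTies tie) (hY : Measurable Y) (hZ : Measurable Z)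
    (hE : ∀ i j, Measurable fun ω => E ω i j) (μ : Fin K → ℝ) (α : ℝ)
    (advice : AgentState K → Finset (Fin K)) (i : Fin N) (T : ℕ) :
    Measurable fun ω => regret μ α (tie ω) (Y ω) (Z ω) (E ω) advice i T := by
  refine Finset.measurable_sum _ fun t _ => Measurable.const_sub ?_ _
  refine (measurable_of_countable μ).comp ?_
  exact measurable_apply_of_countable (measurable_states htie hY hZ hE α advice t)
    (g := fun st ω => pulledArm α (tie ω) (Y ω) (t + 1) st i)
    fun st => measurable_pulledArm htie hY α (t + 1) st i

end Measurability

section RegretBounds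

variable {N K : ℕ} [NeZero K] {μ : Fin K → ℝ}

lemma regret_nonneg (hμ : IsBanditInstance μ) (α tie) (Y : Fin N → Fin K → ℕ → Bool) (Z E advice i)
    (T : ℕ) : 0 ≤ regret μ α tie Y Z E advice i T :=
  Finset.sum_nonneg fun _ _ => sub_nonneg.2 (hμ.antitone (Fin.zero_le _))

lemma regret_le_card (hμ : IsBanditInstance μ) (α tie) (Y : Fin N → Fin K → ℕ → Bool)
    (Z E advice i) (T : ℕ) : regret μ α tie Y Z E advice i T ≤ T := by
  refine (Finset.sum_le_card_nsmul _ _ 1 fun t _ => ?_).trans (by simp)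
  linarith [hμ.lt_one,
    hμ.nonneg (pulledArm α tie Y (t + 1) (states α tie Y Z E advice t) i)]

end RegretBounds

/-! ### Concentration of the empirical means -/

section Concentration

variable {Ω : Type*} [MeasurableSpace Ω] {Pr : Measure Ω} [IsProbabilityMeasure Pr]

/-- Hoeffding's inequality with the confidence radius of the UCB index, for one number `n` of
pulls. -/
lemma measure_empMean_le (y : ℕ → Ω → Bool) (hy : ∀ s, Measurable (y s)) (hind : iIndepFun y Pr)
    {p : ℝ} (hp : 0 ≤ p) (hlaw : ∀ s, Pr {ω | y s ω = true} = ENNReal.ofReal p)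
    {α : ℝ} (hα : 0 < α) {n t : ℕ} (hn : 0 < n) (ht : 0 < t) :
    Pr.real {ω | √(α * Real.log t / n) < |empMean (fun s => y s ω) n - p|} ≤
      2 * (t : ℝ) ^ (-(2 * α)) := by
  set X : ℕ → Ω → ℝ := fun s ω => (if y s ω then (1 : ℝ) else 0) - p with hX
  have hbm : Measurable fun b : Bool => (if b then (1 : ℝ) else 0) := measurable_of_countable _
  have hym : ∀ s, Measurable fun ω => (if y s ω then (1 : ℝ) else 0) := fun s => hbm.comp (hy s)
  have hmean : ∀ s, ∫ ω, (if y s ω then (1 : ℝ) else 0) ∂Pr = p := fun s => by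
    have h1 : (fun ω => (if y s ω then (1 : ℝ) else 0)) =
        Set.indicator {ω | y s ω = true} (fun _ => (1 : ℝ)) := by
      ext ω; simp [Set.indicator_apply]
    have hms : MeasurableSet {ω | y s ω = true} := hy s (measurableSet_singleton true)
    rw [h1, integral_indicator_const _ hms, Measure.real, hlaw, ENNReal.toReal_ofReal hp]
    simp
  have hsub : ∀ s, HasSubgaussianMGF (X s) ((‖(1 : ℝ) - 0‖₊ / 2) ^ 2) Pr := fun s => by
    have := hasSubgaussianMGF_of_mem_Icc (μ := Pr) (hym s).aemeasurable (a := 0) (b := 1)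
      (ae_of_all _ fun ω => by split <;> simp)
    rwa [hmean s] at this
  have hindX : iIndepFun X Pr := hind.comp (fun _ b => (if b then (1 : ℝ) else 0) - p)
    fun _ => hbm.sub_const p
  have hsub' : ∀ s, HasSubgaussianMGF (fun ω => - X s ω) ((‖(1 : ℝ) - 0‖₊ / 2) ^ 2) Pr :=
    fun s => (hsub s).neg
  have hindX' : iIndepFun (fun s ω => - X s ω) Pr := hindX.comp (fun _ x => -x)
    fun _ => measurable_neg
  set r := √(α * Real.log t / n) with hr
  have hlog : 0 ≤ Real.log t := Real.log_natCast_nonneg t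
  have hnr : (0 : ℝ) < n := by exact_mod_cast hn
  have htr : (0 : ℝ) < t := by exact_mod_cast ht
  -- Variables with values in `[0, 1]` are sub-Gaussian with parameter `1 / 4`.
  have hexp : Real.exp (-(n * r) ^ 2 / (2 * n * (((‖(1 : ℝ) - 0‖₊ / 2) ^ 2 : NNReal) : ℝ))) =
      (t : ℝ) ^ (-(2 * α)) := by
    rw [Real.rpow_def_of_pos htr]
    congr 1
    have hc : (((‖(1 : ℝ) - 0‖₊ / 2) ^ 2 : NNReal) : ℝ) = 1 / 4 := by norm_num
    have hsq : r ^ 2 = α * Real.log t / n := by rw [hr, Real.sq_sqrt (by positivity)]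
    rw [hc, mul_pow, hsq]
    field_simp
    ring
  have h1 := HasSubgaussianMGF.measure_sum_range_ge_le_of_iIndepFun hindX (n := n)
    (fun i _ => hsub i) (ε := n * r) (by positivity)
  have h2 := HasSubgaussianMGF.measure_sum_range_ge_le_of_iIndepFun hindX' (n := n)
    (fun i _ => hsub' i) (ε := n * r) (by positivity)
  rw [hexp] at h1 h2
  refine (measureReal_mono (?_ : _ ⊆ {ω | n * r ≤ ∑ i ∈ Finset.range n, X i ω} ∪
    {ω | n * r ≤ ∑ i ∈ Finset.range n, - X i ω})).trans
    ((measureReal_union_le _ _).trans (by linarith))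
  intro ω hω
  have hsum : ∑ i ∈ Finset.range n, X i ω = n * (empMean (fun s => y s ω) n - p) := by
    simp only [hX, Finset.sum_sub_distrib, Finset.sum_const, Finset.card_range, nsmul_eq_mul,
      empMean]
    field_simp
  simp only [Set.mem_ofPred_eq, Set.mem_union, Finset.sum_neg_distrib, hsum] at hω ⊢
  rcases lt_abs.1 hω with h | h
  · left; gcongr
  · right; rw [← mul_neg]; gcongr

variable {N K : ℕ} {μ : Fin K → ℝ} {P : Matrix (Fin N) (Fin N) ℝ}
  {Y : Ω → Fin N → Fin K → ℕ → Bool} {Z : Ω → Fin N → ℕ → Fin N}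

lemma IsNoise.measure_empMean_le (hYZ : IsNoise μ P Y Z Pr) (hμ : ∀ l, 0 ≤ μ l)
    {α : ℝ} (hα : 0 < α) (i : Fin N) (l : Fin K) {n t : ℕ} (hn : 0 < n) (ht : 0 < t) :
    Pr.real {ω | √(α * Real.log t / n) < |empMean (Y ω i l) n - μ l|} ≤
      2 * (t : ℝ) ^ (-(2 * α)) := by
  have hY := hYZ.measurable_reward
  refine GosInE.measure_empMean_le (fun s ω => Y ω i l s) (fun s => by fun_prop) ?_ (hμ l)
    (hYZ.reward_law i l) hα hn ht
  exact hYZ.indep_reward.precomp (g := fun s : ℕ => (i, l, s)) fun a b h => by simpa using h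

/-- The concentration event after slot `s` fails with probability at most of order `s⁻³`: the union
bound over the number of pulls costs a factor `t`, and `t ^ (1 - 2 * α)` is at most
`t⁻⁵ ≤ s⁻³ t⁻²`. -/
lemma IsNoise.measure_not_accurateAfter_le (hYZ : IsNoise μ P Y Z Pr) (hμ : ∀ l, 0 ≤ μ l)
    {α : ℝ} (hα : 3 < α) :
    ∃ c : ℝ, 0 ≤ c ∧ ∀ s : ℕ, 0 < s →
      Pr.real {ω | ¬ AccurateAfter μ α (Y ω) s} ≤ c / (s : ℝ) ^ 3 := by
  have hsummable : Summable fun k : ℕ => 1 / ((k : ℝ) + 1) ^ 2 := by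
    have := (summable_nat_add_iff 1).2 (Real.summable_one_div_nat_pow.2 one_lt_two)
    simpa using this
  refine ⟨2 * N * K * ∑' k : ℕ, 1 / ((k : ℝ) + 1) ^ 2, by positivity, fun s hs => ?_⟩
  have hsr : (0 : ℝ) < s := by exact_mod_cast hs
  set B : ℕ → Fin N × Fin K × ℕ → Set Ω := fun t x =>
    {ω | √(α * Real.log t / x.2.2) < |empMean (Y ω x.1 x.2.1) x.2.2 - μ x.2.1|} with hB
  set I : ℕ → Finset (Fin N × Fin K × ℕ) := fun t =>
    Finset.univ ×ˢ Finset.univ ×ˢ Finset.Icc 1 t with hI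
  have hsub : {ω | ¬ AccurateAfter μ α (Y ω) s} ⊆ ⋃ k, ⋃ x ∈ I (s + 1 + k), B (s + 1 + k) x := by
    intro ω hω
    simp only [AccurateAfter, Set.mem_ofPred_eq, not_forall, not_le] at hω
    obtain ⟨t, hst, i, l, n, hn, hnt, h⟩ := hω
    have ht : s + 1 + (t - (s + 1)) = t := by omega
    refine Set.mem_iUnion.2 ⟨t - (s + 1), Set.mem_iUnion₂.2 ⟨(i, l, n), ?_, ?_⟩⟩
    · rw [ht]
      simp only [hI, Finset.mem_product, Finset.mem_univ, Finset.mem_Icc, true_and]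
      omega
    · rw [ht]
      exact h
  have hterm : ∀ k : ℕ, Pr.real (⋃ x ∈ I (s + 1 + k), B (s + 1 + k) x) ≤
      2 * N * K / (s : ℝ) ^ 3 * (1 / ((k : ℝ) + 1) ^ 2) := fun k => by
    set t := s + 1 + k with ht
    have htr : (1 : ℝ) ≤ t := by exact_mod_cast (by omega : 1 ≤ t)
    have hts : (s : ℝ) ≤ t := by exact_mod_cast (by omega : s ≤ t)
    have htk : (k : ℝ) + 1 ≤ t := by exact_mod_cast (by omega : k + 1 ≤ t)
    calc Pr.real (⋃ x ∈ I t, B t x) ≤ ∑ x ∈ I t, Pr.real (B t x) :=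
          measureReal_biUnion_finset_le _ _
      _ ≤ ∑ x ∈ I t, 2 * (t : ℝ) ^ (-(2 * α)) := Finset.sum_le_sum fun x hx => by
          simp only [hI, Finset.mem_product, Finset.mem_univ, Finset.mem_Icc, true_and] at hx
          exact hYZ.measure_empMean_le hμ (by linarith) _ _ hx.1 (by omega)
      _ ≤ ∑ x ∈ I t, 2 * ((t : ℝ) ^ 6)⁻¹ := by
          gcongr
          rw [← Real.rpow_natCast, ← Real.rpow_neg (by linarith)]
          exact Real.rpow_le_rpow_of_exponent_le htr (by push_cast; linarith)
      _ = 2 * N * K * (1 / (t : ℝ) ^ 3 * (1 / (t : ℝ) ^ 2)) := by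
          rw [Finset.sum_const, nsmul_eq_mul]
          simp only [hI, Finset.card_product, Finset.card_univ, Fintype.card_fin, Nat.card_Icc]
          push_cast
          field_simp
      _ ≤ 2 * N * K * (1 / (s : ℝ) ^ 3 * (1 / ((k : ℝ) + 1) ^ 2)) := by gcongr
      _ = _ := by ring
  have hnn : ∀ k : ℕ, 0 ≤ 2 * N * K / (s : ℝ) ^ 3 * (1 / ((k : ℝ) + 1) ^ 2) := fun k => by positivity
  have hE : Pr {ω | ¬ AccurateAfter μ α (Y ω) s} ≤
      ENNReal.ofReal (∑' k : ℕ, 2 * N * K / (s : ℝ) ^ 3 * (1 / ((k : ℝ) + 1) ^ 2)) := by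
    refine (measure_mono hsub).trans ((measure_iUnion_le _).trans ?_)
    rw [ENNReal.ofReal_tsum_of_nonneg hnn (hsummable.mul_left _)]
    refine ENNReal.tsum_le_tsum fun k => ?_
    rw [← ofReal_measureReal (measure_ne_top _ _)]
    exact ENNReal.ofReal_le_ofReal (hterm k)
  have := ENNReal.toReal_le_of_le_ofReal (tsum_nonneg hnn) hE
  rw [tsum_mul_left] at this
  refine this.trans (le_of_eq ?_)
  ring

/-! ### Contacts -/

/-- Within `n` consecutive phases, every agent contacts each of its possible contacts, with a
failure probability that decays exponentially in `n`. -/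
lemma IsNoise.measure_not_contact_le (hYZ : IsNoise μ P Y Z Pr) {p : ℝ}
    (hP : ∀ i m, 0 ≤ P i m) (hp : ∀ i m, 0 < P i m → p ≤ P i m) (hp1 : p ≤ 1) (b n : ℕ) :
    Pr.real {ω | ¬ ∀ i m, 0 < P i m → ∀ k ≤ b, ∃ j, k ≤ j ∧ j < k + n ∧ Z ω i j = m} ≤
      N * N * (b + 1) * (1 - p) ^ n := by
  have hZ := hYZ.measurable_contact
  have hone : ∀ i m k, 0 < P i m →
      Pr.real (⋂ j ∈ Finset.Ico k (k + n), (fun ω => Z ω i j) ⁻¹' {m}ᶜ) ≤ (1 - p) ^ n := by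
    intro i m k hpos
    have hind : iIndepFun (fun j ω => Z ω i j) Pr :=
      hYZ.indep_contact.precomp (g := fun j : ℕ => (i, j)) fun a b h => by simpa using h
    have h1 := hind.measure_inter_preimage_eq_mul (Finset.Ico k (k + n))
      (sets := fun _ => {m}ᶜ) (fun _ _ => (measurableSet_singleton m).compl)
    rw [Measure.real, h1, ENNReal.toReal_prod]
    have h2 : ∀ j, (Pr ((fun ω => Z ω i j) ⁻¹' {m}ᶜ)).toReal = 1 - P i m := fun j => by
      have hm : MeasurableSet ((fun ω => Z ω i j) ⁻¹' {m}) :=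
        (by fun_prop : Measurable fun ω => Z ω i j) (measurableSet_singleton m)
      have h3 := probReal_compl_eq_one_sub (μ := Pr) hm
      have h4 : Pr ((fun ω => Z ω i j) ⁻¹' {m}) = ENNReal.ofReal (P i m) := hYZ.contact_law i j m
      rw [Set.preimage_compl, ← Measure.real, h3, Measure.real, h4,
        ENNReal.toReal_ofReal (hP i m)]
    simp only [h2, Finset.prod_const, Nat.card_Ico, Nat.add_sub_cancel_left]
    have h5 : 0 ≤ 1 - P i m := by rw [← h2 0]; exact ENNReal.toReal_nonneg
    exact pow_le_pow_left₀ h5 (by linarith [hp i m hpos]) n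
  set I : Finset (Fin N × Fin N × ℕ) :=
    (Finset.univ ×ˢ Finset.univ ×ˢ Finset.range (b + 1)).filter fun x => 0 < P x.1 x.2.1 with hI
  have hsub : {ω | ¬ ∀ i m, 0 < P i m → ∀ k ≤ b, ∃ j, k ≤ j ∧ j < k + n ∧ Z ω i j = m} ⊆
      ⋃ x ∈ I, ⋂ j ∈ Finset.Ico x.2.2 (x.2.2 + n), (fun ω => Z ω x.1 j) ⁻¹' {x.2.1}ᶜ := by
    intro ω hω
    simp only [Set.mem_ofPred_eq, not_forall, not_exists, not_and] at hω
    obtain ⟨i, m, hpos, k, hk, h⟩ := hω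
    refine Set.mem_iUnion₂.2 ⟨(i, m, k), ?_, Set.mem_iInter₂.2 fun j hj => ?_⟩
    · simp only [hI, Finset.mem_filter, Finset.mem_product, Finset.mem_univ, Finset.mem_range,
        true_and]
      exact ⟨by omega, hpos⟩
    · rw [Finset.mem_Ico] at hj
      exact h j hj.1 hj.2
  refine (measureReal_mono hsub (measure_ne_top _ _)).trans
    ((measureReal_biUnion_finset_le _ _).trans ?_)
  refine (Finset.sum_le_card_nsmul _ _ ((1 - p) ^ n) fun x hx => ?_).trans ?_
  · exact hone _ _ _ (Finset.mem_filter.1 hx).2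
  · rw [nsmul_eq_mul]
    have hcard : (I.card : ℝ) ≤ N * N * (b + 1) := by
      have : I.card ≤ N * (N * (b + 1)) := by
        refine (Finset.card_filter_le _ _).trans (le_of_eq ?_)
        simp
      rw [mul_assoc]
      exact_mod_cast this
    have : 0 ≤ 1 - p := by linarith
    gcongr

end Concentration
/-! ### The communication slots -/

section CommSlot

variable {B : ℕ → ℝ} {ε : ℝ}

lemma rpow_le_commSlot (B : ℕ → ℝ) (ε : ℝ) (x : ℕ) :
    (1 + (x : ℝ)) ^ (1 + ε) ≤ commSlot B ε x :=
  (Nat.le_ceil _).trans (Nat.cast_le.2 (le_max_right _ _))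

lemma lt_commSlot (B : ℕ → ℝ) (hε : 0 < ε) (x : ℕ) : x < commSlot B ε x := by
  have h1 : (1 : ℝ) ≤ 1 + x := by linarith [x.cast_nonneg (α := ℝ)]
  have h2 := Real.rpow_le_rpow_of_exponent_le h1 (by linarith : (1 : ℝ) ≤ 1 + ε)
  rw [Real.rpow_one] at h2
  have h3 : (x : ℝ) < commSlot B ε x := by linarith [rpow_le_commSlot B ε x]
  exact_mod_cast h3

lemma commSlot_zero (hB : IsAdmissibleBudget B ε) : commSlot B ε 0 = 1 := by
  have : sInf {t : ℕ | ((0 : ℕ) : ℝ) ≤ B t} = 0 :=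
    Nat.sInf_eq_zero.2 (Or.inl (by simpa using hB.nonneg 0))
  rw [commSlot, this]
  simp

lemma isConvexSchedule_commSlot (hε : 0 < ε) (hB : IsAdmissibleBudget B ε) :
    IsConvexSchedule (commSlot B ε) where
  pos := by rw [commSlot_zero hB]; exact one_pos
  gap_mono := monotone_nat_of_le_succ fun j => by
    rcases j with _ | j
    · have h1 := lt_commSlot B hε 1
      change commSlot B ε 0 ≤ commSlot B ε 1 - commSlot B ε 0
      rw [commSlot_zero hB]
      omega
    · have h := hB.convex j (j + 2) (1 / 2) (by norm_num) (by norm_num)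
      have hf : ⌊(1 / 2 : ℝ) * j + (1 - 1 / 2) * ((j + 2 : ℕ) : ℝ)⌋₊ = j + 1 := by
        have : (1 / 2 : ℝ) * j + (1 - 1 / 2) * ((j + 2 : ℕ) : ℝ) = (j + 1 : ℕ) := by
          push_cast; ring
        rw [this, Nat.floor_natCast]
      rw [hf] at h
      have h2 : 2 * (commSlot B ε (j + 1) : ℝ) ≤ commSlot B ε j + commSlot B ε (j + 2) := by linarith
      have h3 : 2 * commSlot B ε (j + 1) ≤ commSlot B ε j + commSlot B ε (j + 2) := by
        exact_mod_cast h2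
      change commSlot B ε (j + 1) - commSlot B ε j ≤
        commSlot B ε (j + 2) - commSlot B ε (j + 1)
      omega

lemma IsConvexSchedule.le_succ_mul_gap {A : ℕ → ℕ} (hA : IsConvexSchedule A) (j : ℕ) :
    A j ≤ (j + 1) * gap A j := by
  induction j with
  | zero => simp [gap]
  | succ j ih =>
    have h1 : gap A j ≤ gap A (j + 1) := hA.gap_mono (Nat.le_succ j)
    rw [hA.succ j, Nat.succ_mul (j + 1)]
    exact Nat.add_le_add_right (ih.trans (Nat.mul_le_mul_left _ h1)) _

/-- The phases outgrow the logarithm of the time: by convexity the length of phase `j` is at least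
`A_j / (j + 1)`, which is at least a positive power of `A_j`. -/
lemma exists_log_lt_gap (hε : 0 < ε) (hB : IsAdmissibleBudget B ε) (C κ : ℝ) (M : ℕ) (hM : 0 < M) :
    ∃ r, ∀ j ≥ r, κ * (C * Real.log (M * commSlot B ε j) + 1) < gap (commSlot B ε) j := by
  have hA := isConvexSchedule_commSlot hε hB
  set A := commSlot B ε with hAdef
  set θ := ε / (1 + ε) with hθ
  have hθ0 : 0 < θ := by positivity
  have hlim : Tendsto (fun j => (A j : ℝ)) atTop atTop :=
    tendsto_natCast_atTop_atTop.comp hA.strictMono.tendsto_atTop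
  have ho : (fun x : ℝ => κ * (C * Real.log M + 1) + κ * C * Real.log x) =o[atTop]
      fun x => x ^ θ := by
    refine Asymptotics.IsLittleO.add ?_ ((isLittleO_log_rpow_atTop hθ0).const_mul_left _)
    refine Asymptotics.isLittleO_const_left.2 (Or.inr ?_)
    exact tendsto_norm_atTop_atTop.comp (tendsto_rpow_atTop hθ0)
  have hev := (ho.def (by norm_num : (0 : ℝ) < 1 / 2)).and (eventually_gt_atTop 0)
  obtain ⟨r, hr⟩ := eventually_atTop.1 (hlim.eventually hev)
  refine ⟨r, fun j hj => ?_⟩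
  obtain ⟨h1, hpos⟩ := hr j hj
  have hpow : 0 < (A j : ℝ) ^ θ := Real.rpow_pos_of_pos hpos θ
  rw [Real.norm_of_nonneg hpow.le] at h1
  have h2 := (le_abs_self _).trans h1
  have hMr : (M : ℝ) ≠ 0 := by exact_mod_cast hM.ne'
  have h3 : κ * (C * Real.log (M * A j) + 1) =
      κ * (C * Real.log M + 1) + κ * C * Real.log (A j) := by
    rw [Real.log_mul hMr hpos.ne']; ring
  rw [h3]
  have h4 : (A j : ℝ) ^ θ ≤ gap A j := by
    have hj0 : (0 : ℝ) < 1 + j := by positivity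
    have h5 : (A j : ℝ) ≤ (1 + j) * gap A j := by
      have := hA.le_succ_mul_gap j
      rw [add_comm (1 : ℝ)]
      exact_mod_cast this
    have h6 : (1 + (j : ℝ)) ≤ (A j : ℝ) ^ (1 / (1 + ε)) := by
      have := Real.rpow_le_rpow (by positivity) (rpow_le_commSlot B ε j)
        (by positivity : 0 ≤ 1 / (1 + ε))
      rwa [← Real.rpow_mul hj0.le, mul_one_div_cancel (by linarith), Real.rpow_one] at this
    have h7 : (A j : ℝ) ^ (1 / (1 + ε)) * (A j : ℝ) ^ θ = A j := by
      rw [← Real.rpow_add hpos, hθ, ← add_div, div_self (by linarith), Real.rpow_one]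
    have h8 : (1 + (j : ℝ)) * (A j : ℝ) ^ θ ≤ (1 + j) * gap A j := by
      refine le_trans ?_ h5
      calc (1 + (j : ℝ)) * (A j : ℝ) ^ θ ≤ (A j : ℝ) ^ (1 / (1 + ε)) * (A j : ℝ) ^ θ := by gcongr
        _ = A j := h7
    exact le_of_mul_le_mul_left h8 hj0
  linarith

/-- Since the budget exceeds every multiple of the logarithm, the communication slots grow more
slowly than every exponential function. -/
lemma exists_commSlot_le_exp (hε : 0 < ε) (hB : IsAdmissibleBudget B ε) {η : ℝ} (hη : 0 < η) :
    ∃ c : ℝ, 0 ≤ c ∧ ∀ x : ℕ, (commSlot B ε x : ℝ) ≤ c * Real.exp (η * x) := by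
  obtain ⟨t₀, ht₀⟩ := hB.log_le (1 / η) (by positivity)
  set b := η / (1 + ε) with hb
  have hb0 : 0 < b := by positivity
  refine ⟨(t₀ + 2) + ((1 + 1 / b) ^ (1 + ε) + 1), by positivity, fun x => ?_⟩
  have hexp : 1 ≤ Real.exp (η * x) := Real.one_le_exp (by positivity)
  have h1 : ((sInf {t : ℕ | (x : ℝ) ≤ B t} : ℕ) : ℝ) ≤ (t₀ + 2) * Real.exp (η * x) := by
    set t := max t₀ ⌈Real.exp (η * x)⌉₊ with ht
    have hle : Real.exp (η * x) ≤ t :=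
      (Nat.le_ceil _).trans (by exact_mod_cast le_max_right _ _)
    have hlog : η * x ≤ Real.log t := by
      rw [Real.le_log_iff_exp_le (by linarith)]
      exact hle
    have hBt : (x : ℝ) ≤ B t := by
      refine le_trans ?_ (ht₀ t (le_max_left _ _))
      rw [one_div, ← div_eq_inv_mul, le_div_iff₀ hη]
      linarith
    have h2 : sInf {t : ℕ | (x : ℝ) ≤ B t} ≤ t := Nat.sInf_le hBt
    have h3 : t ≤ t₀ + ⌈Real.exp (η * x)⌉₊ := by omega
    have h4 : (⌈Real.exp (η * x)⌉₊ : ℝ) < Real.exp (η * x) + 1 := Nat.ceil_lt_add_one (by positivity)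
    have h5 : ((sInf {t : ℕ | (x : ℝ) ≤ B t} : ℕ) : ℝ) ≤ t₀ + ⌈Real.exp (η * x)⌉₊ := by
      exact_mod_cast h2.trans h3
    nlinarith [t₀.cast_nonneg (α := ℝ)]
  have h2 : (⌈(1 + (x : ℝ)) ^ (1 + ε)⌉₊ : ℝ) ≤ ((1 + 1 / b) ^ (1 + ε) + 1) * Real.exp (η * x) := by
    have h3 : (1 + (x : ℝ)) ≤ (1 + 1 / b) * Real.exp (b * x) := by
      have h4 : b * x + 1 ≤ Real.exp (b * x) := Real.add_one_le_exp _
      have h5 : (1 + 1 / b) * (b * x + 1) = 1 + x + b * x + 1 / b := by field_simp; ring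
      have h6 : (1 + 1 / b) * (b * x + 1) ≤ (1 + 1 / b) * Real.exp (b * x) := by gcongr
      have h7 : 0 ≤ b * x + 1 / b := by positivity
      linarith
    have h4 : (1 + (x : ℝ)) ^ (1 + ε) ≤ (1 + 1 / b) ^ (1 + ε) * Real.exp (η * x) := by
      refine (Real.rpow_le_rpow (by positivity) h3 (by linarith)).trans (le_of_eq ?_)
      rw [Real.mul_rpow (by positivity) (by positivity), ← Real.exp_mul]
      congr 2
      rw [hb]
      field_simp
    have h5 : (⌈(1 + (x : ℝ)) ^ (1 + ε)⌉₊ : ℝ) < (1 + (x : ℝ)) ^ (1 + ε) + 1 :=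
      Nat.ceil_lt_add_one (by positivity)
    linarith
  have h3 : (commSlot B ε x : ℝ) ≤
      (sInf {t : ℕ | (x : ℝ) ≤ B t} : ℕ) + (⌈(1 + (x : ℝ)) ^ (1 + ε)⌉₊ : ℕ) := by
    rw [← Nat.cast_add]
    exact Nat.cast_le.2 (max_le_add_of_nonneg (Nat.zero_le _) (Nat.zero_le _))
  rw [add_mul]
  linarith

/-- The probabilities of the two kinds of failure at level `l` are summable with the weights
`A_{2 (l + 1)}`. -/
lemma summable_commSlot_mul (hε : 0 < ε) (hB : IsAdmissibleBudget B ε) (c n : ℝ) {p : ℝ}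
    (hp0 : 0 < p) (hp1 : p < 1) (q : ℕ) (hq : 0 < q) :
    Summable fun l : ℕ => (commSlot B ε (2 * (l + 1)) : ℝ) *
      (c / (commSlot B ε l : ℝ) ^ 3 +
        n * ((2 * l : ℕ) + 1) * (1 - p) ^ ((l - 1) / q - 3 + 1)) := by
  refine (Summable.add ?_ ?_).congr fun l => (mul_add _ _ _).symm
  · rw [← summable_nat_add_iff 1]
    refine (hB.summable.mul_left c).congr fun l => ?_
    ring_nf
  · obtain ⟨θ, hθ0, hθ⟩ : ∃ θ : ℝ, 0 < θ ∧ 1 - p = Real.exp (-θ) :=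
      ⟨-Real.log (1 - p), neg_pos.2 (Real.log_neg (by linarith) (by linarith)), by
        rw [neg_neg, Real.exp_log (by linarith)]⟩
    have hqr : (0 : ℝ) < q := by exact_mod_cast hq
    -- The failure probability decays like `exp (-4 η l)`, while `A_{2 (l + 1)}` grows at most like
    -- `exp (2 η l)`.
    set η := θ / (4 * q) with hη
    have hη0 : 0 < η := by positivity
    obtain ⟨b, hb0, hb⟩ := exists_commSlot_le_exp hε hB hη0
    have hs : Summable fun l : ℕ =>
        (b * |n| * Real.exp (2 * η + 3 * θ)) *
          (2 * ((l : ℝ) ^ 1 * Real.exp (-(2 * η) * l)) +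
            (l : ℝ) ^ 0 * Real.exp (-(2 * η) * l)) :=
      (((Real.summable_pow_mul_exp_neg_nat_mul 1 (by positivity)).mul_left 2).add
        (Real.summable_pow_mul_exp_neg_nat_mul 0 (by positivity))).mul_left _
    refine Summable.of_norm_bounded hs fun l => ?_
    have hdiv : (l : ℝ) / q - 3 ≤ ((l - 1) / q - 3 + 1 : ℕ) := by
      have h1 : l ≤ q * ((l - 1) / q + 1) := by
        have := Nat.lt_mul_div_succ (l - 1) hq
        rw [Nat.add_one] at *
        omega
      have h2 : (l : ℝ) / q ≤ ((l - 1) / q : ℕ) + 1 := by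
        rw [div_le_iff₀' hqr]
        exact_mod_cast h1
      have h3 : ((l - 1) / q : ℕ) ≤ ((l - 1) / q - 3 + 1) + 2 := by omega
      have h4 : (((l - 1) / q : ℕ) : ℝ) ≤ ((l - 1) / q - 3 + 1 : ℕ) + 2 := by exact_mod_cast h3
      linarith
    have hpow : (1 - p) ^ ((l - 1) / q - 3 + 1) ≤ Real.exp (3 * θ) * Real.exp (-(4 * η) * l) := by
      rw [hθ, ← Real.exp_nat_mul, ← Real.exp_add]
      apply Real.exp_le_exp.2
      have : 4 * η * l = θ * (l / q) := by rw [hη]; field_simp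
      nlinarith
    have hA : (commSlot B ε (2 * (l + 1)) : ℝ) ≤ b * Real.exp (2 * η + 2 * η * l) := by
      refine (hb _).trans (le_of_eq ?_)
      congr 2
      push_cast
      ring
    have hp' : 0 ≤ (1 - p) ^ ((l - 1) / q - 3 + 1) := pow_nonneg (by linarith) _
    rw [norm_mul, norm_mul, norm_mul, Real.norm_of_nonneg hp', Real.norm_natCast, Real.norm_eq_abs n,
      Real.norm_of_nonneg (by positivity)]
    calc (commSlot B ε (2 * (l + 1)) : ℝ) *
          (|n| * (((2 * l : ℕ) : ℝ) + 1) * (1 - p) ^ ((l - 1) / q - 3 + 1))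
        ≤ (b * Real.exp (2 * η + 2 * η * l)) * (|n| * (((2 * l : ℕ) : ℝ) + 1) *
          (Real.exp (3 * θ) * Real.exp (-(4 * η) * l))) := by gcongr
      _ = (b * |n|) * (2 * l + 1) *
          (Real.exp (2 * η + 2 * η * l) * (Real.exp (3 * θ) * Real.exp (-(4 * η) * l))) := by
          push_cast; ring
      _ = (b * |n|) * (2 * l + 1) * (Real.exp (2 * η + 3 * θ) * Real.exp (-(2 * η) * l)) := by
          congr 1
          rw [← Real.exp_add, ← Real.exp_add, ← Real.exp_add]
          congr 1
          ring
      _ = _ := by ring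

end CommSlot
/-! ### From the failure probabilities to the expected regret -/

section Expectation

variable {N K : ℕ} [NeZero K] {μ : Fin K → ℝ} {P : Matrix (Fin N) (Fin N) ℝ} {α ε : ℝ} {B : ℕ → ℝ}

/-- The leading constant of the regret bound. -/
noncomputable def regretConst (N : ℕ) {K : ℕ} [NeZero K] (μ : Fin K → ℝ) (α : ℝ) : ℝ :=
  ∑ l : Fin K with 1 ≤ l.val ∧ l.val ≤ K ⌈/⌉ N + 1, 4 * α / (μ 0 - μ l)

/-- The success event at level `l`: the confidence radii are valid after slot `A_l`, and every
window of `(l - 1) / q - 3 + 1` phases contains all possible contacts. The divisor `q` is chosen so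
large that all rounds of spreading fit between the slots `A_l` and `A_{2 l}`. -/
def Succeeds (μ : Fin K → ℝ) (P : Matrix (Fin N) (Fin N) ℝ) (α : ℝ) (A : ℕ → ℕ) (q l : ℕ)
    (Y : Fin N → Fin K → ℕ → Bool) (Z : Fin N → ℕ → Fin N) : Prop :=
  AccurateAfter μ α Y (A l) ∧
    ∀ i m, 0 < P i m → ∀ k ≤ 2 * l, ∃ j, k ≤ j ∧ j < k + ((l - 1) / q - 3 + 1) ∧ Z i j = m

/-- On the success event at a high level `l`, the playing sets are frozen by slot `A_{2 l}`. -/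
lemma exists_regret_le_of_succeeds (hN : 0 < N) (hμ : IsBanditInstance μ) (hP : ∀ i m, 0 ≤ P i m)
    (hirr : P.IsIrreducible) (hα : 0 < α) (hε : 0 < ε) (hB : IsAdmissibleBudget B ε) (M : ℕ)
    (hM : 0 < M) :
    ∃ q, 0 < q ∧ ∃ l₀, ∀ l ≥ l₀, ∀ G : Run N K, G.α = α →
      (∀ i, IsTimetable (commSlot B ε) M (G.phaseEnd i)) →
      ((G.advice = (fun st => argmaxSet st.active st.phasePulls) ∧
          ∀ i k, G.phaseEnd i = G.phaseEnd k) ∨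
        G.advice = fun st => argmaxSet st.prevActive st.prevPulls) →
      Succeeds μ P α (commSlot B ε) q l G.Y G.Z → ∀ i T,
      regret μ G.α G.tie G.Y G.Z G.phaseEnd G.advice i T ≤
        commSlot B ε (2 * l) + K + regretConst N μ α * Real.log T := by
  have hA := isConvexSchedule_commSlot hε hB
  set A := commSlot B ε with hAdef
  set C := ∑ l, 4 * α / (μ 0 - μ l) ^ 2 with hC
  have hCnn : ∀ l, 0 ≤ 4 * α / (μ 0 - μ l) ^ 2 := fun l => by positivity
  have hCle : ∀ l, 4 * α / (μ 0 - μ l) ^ 2 ≤ C := fun l =>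
    Finset.single_le_sum (f := fun l => 4 * α / (μ 0 - μ l) ^ 2) (fun l _ => hCnn l)
      (Finset.mem_univ l)
  obtain ⟨r, hr⟩ := exists_log_lt_gap hε hB C K M hM
  choose w hwpos hw using fun i =>
    (Matrix.isIrreducible_iff_exists_pow_pos hP).1 hirr i (⟨0, hN⟩ : Fin N)
  set H := Finset.univ.sup w with hH
  set q := (M + 1) * (H + 1) with hq
  have hqpos : 0 < q := by positivity
  -- For `l ≥ M * A r`, every phase that starts after slot `A l` has a number above `r`. For
  -- `l ≥ 3 * q + 1`, the window length `(l - 1) / q - 3 + 1` has no truncated subtraction, and `H + 1`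
  -- rounds with such windows fit between the slots `A l` and `A (2 * l)`.
  refine ⟨q, hqpos, max (M * A r) (3 * q + 1), fun l hl G hGα htime hadv hsucc i T => ?_⟩
  have hl1 : M * A r ≤ l := le_of_max_le_left hl
  have hl2 : 3 * q + 1 ≤ l := le_of_max_le_right hl
  have h : G.IsAccurate μ A M C (A l) :=
    { bandit := hμ
      alpha_pos := hGα ▸ hα
      schedule := hA
      timetable := htime
      advice := hadv
      accurate := hGα ▸ hsucc.1
      le_const := fun l _ => hGα ▸ hCle l
      const_nonneg := Finset.sum_nonneg fun l _ => hCnn l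
      long := fun k j hj => by
        have h1 := (htime k).le_mul_schedule hA j
        have h2 := (htime k).le_end j
        have h3 : phaseStart (G.phaseEnd k) j ≤ G.phaseEnd k j := by omega
        have h4 : M * A r < M * A j :=
          (hl1.trans_lt (lt_commSlot B hε l)).trans_le (hj.trans (h3.trans h1))
        have h5 : r < j := hA.strictMono.lt_iff_lt.1 (lt_of_mul_lt_mul_left h4 (Nat.zero_le M))
        have h6 := hr j h5.le
        have h7 : Real.log (G.phaseEnd k j) ≤ Real.log (M * A j) := by
          refine Real.log_le_log ?_ (by exact_mod_cast h1)
          have := hA.gap_pos j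
          exact_mod_cast (by omega : 0 < G.phaseEnd k j)
        have h8 : (K : ℝ) * (C * Real.log (G.phaseEnd k j) + 1) ≤
            K * (C * Real.log (M * A j) + 1) := by
          have : 0 ≤ C := Finset.sum_nonneg fun l _ => hCnn l
          gcongr
        have h9 : (phaseStart (G.phaseEnd k) j : ℝ) + gap A j ≤ G.phaseEnd k j := by
          exact_mod_cast h2
        linarith }
  have hL : (M + 1) * (((l - 1) / q - 3) + 3) * (H + 1) + 1 ≤ l := by
    have h1 : 3 ≤ (l - 1) / q := (Nat.le_div_iff_mul_le hqpos).2 (by omega)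
    have h2 := Nat.mul_div_le (l - 1) q
    rw [Nat.sub_add_cancel h1]
    have h3 : (M + 1) * ((l - 1) / q) * (H + 1) = q * ((l - 1) / q) := by rw [hq]; ring
    omega
  have hfin := h.regret_le hP (l := l) le_rfl hsucc.2 (Run.zero_mem_sticky N K (i := ⟨0, hN⟩) rfl)
    (H := H) (fun i => ⟨w i, Finset.le_sup (Finset.mem_univ i), hw i⟩) hL i T
  rw [hGα] at hfin
  exact hfin

variable {Ω : Type*} [MeasurableSpace Ω] {Pr : Measure Ω} [IsProbabilityMeasure Pr]
  {Y : Ω → Fin N → Fin K → ℕ → Bool} {Z : Ω → Fin N → ℕ → Fin N}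

lemma IsNoise.summable_not_succeeds (hYZ : IsNoise μ P Y Z Pr) (hμ : IsBanditInstance μ)
    (hP : ∀ i m, 0 ≤ P i m) (hα : 3 < α) (hε : 0 < ε) (hB : IsAdmissibleBudget B ε) {q : ℕ}
    (hq : 0 < q) :
    Summable fun l : ℕ => (commSlot B ε (2 * (l + 1)) : ℝ) *
      Pr.real {ω | ¬ Succeeds μ P α (commSlot B ε) q l (Y ω) (Z ω)} := by
  obtain ⟨c, hc0, hc⟩ := hYZ.measure_not_accurateAfter_le hμ.nonneg hα
  obtain ⟨p, hp, hp0, hp1⟩ : ∃ p : ℝ, (∀ i m, 0 < P i m → p ≤ P i m) ∧ 0 < p ∧ p < 1 := by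
    have h1 : ∀ᶠ p : ℝ in nhdsWithin 0 (Set.Ioi 0), ∀ i m, 0 < P i m → p ≤ P i m := by
      refine eventually_all.2 fun i => eventually_all.2 fun m => ?_
      by_cases h : 0 < P i m
      · filter_upwards [nhdsWithin_le_nhds (eventually_le_nhds h)] with p hp _ using hp
      · exact Eventually.of_forall fun p h' => absurd h' h
    have h2 : ∀ᶠ p : ℝ in nhdsWithin 0 (Set.Ioi 0), p ∈ Set.Ioo (0 : ℝ) 1 :=
      Ioo_mem_nhdsGT one_pos
    exact (h1.and h2).exists
  refine Summable.of_nonneg_of_le (fun l => by positivity) (fun l => ?_)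
    (summable_commSlot_mul hε hB c ((N : ℝ) * N) hp0 hp1 q hq)
  refine mul_le_mul_of_nonneg_left ?_ (Nat.cast_nonneg _)
  have hsub : {ω | ¬ Succeeds μ P α (commSlot B ε) q l (Y ω) (Z ω)} ⊆
      {ω | ¬ AccurateAfter μ α (Y ω) (commSlot B ε l)} ∪
      {ω | ¬ ∀ i m, 0 < P i m → ∀ k ≤ 2 * l, ∃ j, k ≤ j ∧ j < k + ((l - 1) / q - 3 + 1) ∧
        Z ω i j = m} := fun ω hω => not_and_or.1 hω
  refine (measureReal_mono hsub (measure_ne_top _ _)).trans ((measureReal_union_le _ _).trans ?_)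
  exact add_le_add (hc _ ((Nat.zero_le l).trans_lt (lt_commSlot B hε l)))
    (hYZ.measure_not_contact_le hP hp hp1.le _ _)

/-- If level `l + 1` is only paid for when level `l` fails, then a nonnegative quantity that is
bounded by `v l` when some level `l` succeeds, and by `v n` in any case, is bounded by a sum. -/
lemma le_add_sum_indicator {Ω : Type*} {v : ℕ → ℝ} (hv : ∀ k, 0 ≤ v k) {D : ℕ → Set Ω} {ω : Ω}
    {x y : ℝ} (hy : 0 ≤ y) {n : ℕ} (hx : ∀ k, ω ∉ D k → x ≤ v k + y) (hn : x ≤ v n) :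
    x ≤ v 0 + ∑ k ∈ Finset.range n, (D k).indicator (fun _ => v (k + 1)) ω + y := by
  have hind : ∀ k, 0 ≤ (D k).indicator (fun _ => v (k + 1)) ω := fun k =>
    Set.indicator_nonneg (fun _ _ => hv _) ω
  suffices ∀ m, x ≤ v 0 + ∑ k ∈ Finset.range m, (D k).indicator (fun _ => v (k + 1)) ω + y ∨
      v m ≤ v 0 + ∑ k ∈ Finset.range m, (D k).indicator (fun _ => v (k + 1)) ω by
    rcases this n with h | h <;> linarith
  intro m
  induction m with
  | zero => right; simp
  | succ m ih =>
    rw [Finset.sum_range_succ]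
    rcases ih with h | h
    · left; linarith [hind m]
    · by_cases hω : ω ∈ D m
      · right
        rw [Set.indicator_of_mem hω]
        have := Finset.sum_nonneg fun k (_ : k ∈ Finset.range m) => hind k
        linarith [hv 0]
      · left
        linarith [hx m hω, hind m]

/-- Both algorithms at once: the phases end in random slots `E`. -/
theorem limsup_regret_le (hN : 0 < N) (hμ : IsBanditInstance μ) (hP : ∀ i m, 0 ≤ P i m)
    (hirr : P.IsIrreducible) (hα : 3 < α) (hε : 0 < ε) (hB : IsAdmissibleBudget B ε) {M : ℕ}
    (hM : 0 < M) {tie : Ω → TieBreak N K} (htie : MeasurableTies tie) (hYZ : IsNoise μ P Y Z Pr)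
    {E : Ω → Fin N → ℕ → ℕ} (hEm : ∀ i j, Measurable fun ω => E ω i j)
    (hE : ∀ᵐ ω ∂Pr, ∀ i, IsTimetable (commSlot B ε) M (E ω i))
    {advice : AgentState K → Finset (Fin K)}
    (hadv : (advice = (fun st => argmaxSet st.active st.phasePulls) ∧
        ∀ ω i k, E ω i = E ω k) ∨
      advice = fun st => argmaxSet st.prevActive st.prevPulls) (i : Fin N) :
    (∀ T, Integrable (fun ω => regret μ α (tie ω) (Y ω) (Z ω) (E ω) advice i T) Pr) ∧
    limsup (fun T : ℕ => (((∫ ω, regret μ α (tie ω) (Y ω) (Z ω) (E ω) advice i T ∂Pr) /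
      Real.log T : ℝ) : EReal)) atTop ≤ (regretConst N μ α : EReal) := by
  have hint : ∀ T, Integrable (fun ω => regret μ α (tie ω) (Y ω) (Z ω) (E ω) advice i T) Pr :=
    fun T => Integrable.of_bound
      (measurable_regret htie hYZ.measurable_reward hYZ.measurable_contact hEm μ α advice i
        T).aestronglyMeasurable T (ae_of_all _ fun ω => by
        rw [Real.norm_of_nonneg (regret_nonneg hμ _ _ _ _ _ _ _ _)]
        exact regret_le_card hμ _ _ _ _ _ _ _ _)
  refine ⟨hint, ?_⟩
  have hA := isConvexSchedule_commSlot hε hB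
  obtain ⟨q, hq, l₀, hdet⟩ :=
    exists_regret_le_of_succeeds hN hμ hP hirr (by linarith : 0 < α) hε hB M hM
  have hsum := hYZ.summable_not_succeeds hμ hP hα hε hB hq
  set A := commSlot B ε with hAdef
  set R : ℕ → Ω → ℝ := fun T ω => regret μ α (tie ω) (Y ω) (Z ω) (E ω) advice i T with hR
  -- The failure events are replaced by measurable sets of the same probability.
  set D : ℕ → Set Ω := fun k => toMeasurable Pr {ω | ¬ Succeeds μ P α A q (l₀ + k) (Y ω) (Z ω)}
    with hD
  set v : ℕ → ℝ := fun k => A (2 * (l₀ + k)) with hv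
  have hconst : 0 ≤ regretConst N μ α := Finset.sum_nonneg fun l _ => by
    have := sub_nonneg.2 (hμ.antitone (Fin.zero_le l))
    positivity
  have hpt : ∀ T : ℕ, ∀ᵐ ω ∂Pr, R T ω ≤
      v 0 + ∑ k ∈ Finset.range T, (D k).indicator (fun _ => v (k + 1)) ω +
        (K + regretConst N μ α * Real.log T) := fun T => by
    filter_upwards [hE] with ω hω
    have hlog : 0 ≤ Real.log T := Real.log_natCast_nonneg T
    refine le_add_sum_indicator (v := v) (D := D) (fun k => Nat.cast_nonneg _)
      (by positivity) (fun k hk => ?_) ?_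
    · have hs : Succeeds μ P α A q (l₀ + k) (Y ω) (Z ω) := by
        by_contra hcon
        exact hk (subset_toMeasurable _ _ hcon)
      have := hdet (l₀ + k) (Nat.le_add_right _ _)
        ⟨α, tie ω, Y ω, Z ω, E ω, advice⟩ rfl hω (hadv.imp_left fun h => ⟨h.1, h.2 ω⟩) hs i T
      rw [← add_assoc]
      exact this
    · refine (regret_le_card hμ _ _ _ _ _ _ _ _).trans (Nat.cast_le.2 ?_)
      have : 2 * (l₀ + T) < A (2 * (l₀ + T)) := lt_commSlot B hε _
      omega
  set c := v 0 + ∑' l : ℕ, (A (2 * (l + 1)) : ℝ) *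
      Pr.real {ω | ¬ Succeeds μ P α A q l (Y ω) (Z ω)} + K with hc
  have hbound : ∀ T : ℕ, ∫ ω, R T ω ∂Pr ≤ regretConst N μ α * Real.log T + c := fun T => by
    have hDm : ∀ k, MeasurableSet (D k) := fun k => measurableSet_toMeasurable _ _
    have hi : ∀ k, Integrable ((D k).indicator fun _ => v (k + 1)) Pr := fun k =>
      (integrable_const _).indicator (hDm k)
    have hi1 : Integrable (fun ω => ∑ k ∈ Finset.range T,
        (D k).indicator (fun _ => v (k + 1)) ω) Pr := integrable_finsetSum _ fun k _ => hi k
    have h1 := integral_mono_ae (hint T)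
      (((integrable_const (v 0)).add hi1).add
        (integrable_const ((K : ℝ) + regretConst N μ α * Real.log T))) (hpt T)
    refine h1.trans ?_
    rw [integral_add' ((integrable_const _).add hi1) (integrable_const _),
      integral_add' (integrable_const _) hi1, integral_finsetSum _ fun k _ => hi k]
    simp only [integral_const, probReal_univ, one_smul]
    have h2 : ∑ k ∈ Finset.range T, ∫ ω, (D k).indicator (fun _ => v (k + 1)) ω ∂Pr ≤
        ∑' l : ℕ, (A (2 * (l + 1)) : ℝ) *
          Pr.real {ω | ¬ Succeeds μ P α A q l (Y ω) (Z ω)} := by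
      have h3 : ∀ k, ∫ ω, (D k).indicator (fun _ => v (k + 1)) ω ∂Pr =
          (A (2 * ((l₀ + k) + 1)) : ℝ) *
            Pr.real {ω | ¬ Succeeds μ P α A q (l₀ + k) (Y ω) (Z ω)} := fun k => by
        rw [integral_indicator_const _ (hDm k), smul_eq_mul, mul_comm, Measure.real,
          measure_toMeasurable, ← Measure.real]
        rfl
      simp only [h3]
      refine (Finset.sum_map (Finset.range T) (addLeftEmbedding l₀) fun l =>
        (A (2 * (l + 1)) : ℝ) * Pr.real {ω | ¬ Succeeds μ P α A q l (Y ω) (Z ω)}).ge.trans ?_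
      exact hsum.sum_le_tsum _ fun l _ => by positivity
    rw [hc]
    linarith
  have hlogT : Tendsto (fun T : ℕ => Real.log T) atTop atTop :=
    Real.tendsto_log_atTop.comp tendsto_natCast_atTop_atTop
  have hlim : Tendsto (fun T : ℕ => ((regretConst N μ α + c / Real.log T : ℝ) : EReal)) atTop
      (nhds (regretConst N μ α : EReal)) := by
    refine (continuous_coe_real_ereal.tendsto _).comp ?_
    simpa using (hlogT.const_div_atTop c).const_add (regretConst N μ α)
  rw [← hlim.limsup_eq]
  refine limsup_le_limsup ?_
  filter_upwards [hlogT.eventually_gt_atTop 0] with T hT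
  refine EReal.coe_le_coe_iff.2 ?_
  rw [div_le_iff₀ hT, add_mul, div_mul_cancel₀ _ hT.ne']
  exact hbound T

end Expectation
/-! ### The timetables of the two algorithms -/

lemma isTimetable_self {A : ℕ → ℕ} (hA : IsConvexSchedule A) : IsTimetable A 1 A := by
  have h : ∀ j, phaseStart A j + gap A j = A j := fun j => by
    cases j with
    | zero => simp [phaseStart, gap]
    | succ j => exact (hA.succ j).symm
  exact ⟨fun j => (h j).le, fun j => by rw [one_mul, h j]⟩

lemma isTimetable_sum {A W : ℕ → ℕ} {M : ℕ} (h1 : ∀ j, gap A j ≤ W j)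
    (h2 : ∀ j, W j ≤ M * gap A j) : IsTimetable A M fun j => ∑ y ∈ Finset.range (j + 1), W y := by
  have h : ∀ j, phaseStart (fun j => ∑ y ∈ Finset.range (j + 1), W y) j + W j =
      ∑ y ∈ Finset.range (j + 1), W y := fun j => by
    cases j with
    | zero => simp [phaseStart]
    | succ j => exact (Finset.sum_range_succ W (j + 1)).symm
  exact ⟨fun j => (Nat.add_le_add_left (h1 j) _).trans (h j).le,
    fun j => (h j).ge.trans (Nat.add_le_add_left (h2 j) _)⟩

/-- The probabilities of the values in the range of the uniform distribution sum to `1`, so almost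
surely all phase lengths are in this range. -/
lemma IsPhaseLengths.ae_mem {N K : ℕ} {Ω : Type*} [MeasurableSpace Ω] {Pr : Measure Ω}
    [IsProbabilityMeasure Pr] {A : ℕ → ℕ} {δ : ℝ} (hδ : 0 ≤ δ)
    {Y : Ω → Fin N → Fin K → ℕ → Bool} {Z : Ω → Fin N → ℕ → Fin N} {W : Ω → Fin N → ℕ → ℕ}
    (hW : IsPhaseLengths A δ Y Z W Pr) : ∀ᵐ ω ∂Pr, ∀ i j, W ω i j ∈ phaseLengthRange A δ j := by
  refine ae_all_iff.2 fun i => ae_all_iff.2 fun j => ?_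
  have hWm := hW.measurable
  have hm : Measurable fun ω => W ω i j := by fun_prop
  have hcard : (phaseLengthRange A δ j).card ≠ 0 := by
    rw [Finset.card_ne_zero]
    refine ⟨gap A j, Finset.mem_Icc.2 ⟨le_rfl, Nat.le_floor ?_⟩⟩
    have : (0 : ℝ) ≤ gap A j := Nat.cast_nonneg _
    nlinarith
  have hset : (fun ω => W ω i j) ⁻¹' ↑(phaseLengthRange A δ j) =
      ⋃ n ∈ phaseLengthRange A δ j, {ω | W ω i j = n} := by
    ext ω; simp
  have h1 : Pr ((fun ω => W ω i j) ⁻¹' ↑(phaseLengthRange A δ j)) = 1 := by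
    rw [hset, measure_biUnion_finset]
    · rw [Finset.sum_congr rfl fun n hn => hW.law i j n hn, Finset.sum_const, nsmul_eq_mul]
      exact ENNReal.mul_inv_cancel (by exact_mod_cast hcard) (ENNReal.natCast_ne_top _)
    · intro a _ b _ hab
      exact Set.disjoint_left.2 fun ω ha hb => hab (ha.symm.trans hb)
    · exact fun n _ => hm (measurableSet_singleton n)
  exact (mem_ae_iff_prob_eq_one (hm (Finset.measurableSet _))).2 h1

lemma IsPhaseLengths.ae_isTimetable {N K : ℕ} {Ω : Type*} [MeasurableSpace Ω] {Pr : Measure Ω}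
    [IsProbabilityMeasure Pr] {A : ℕ → ℕ} {δ : ℝ} (hδ : 0 ≤ δ)
    {Y : Ω → Fin N → Fin K → ℕ → Bool} {Z : Ω → Fin N → ℕ → Fin N} {W : Ω → Fin N → ℕ → ℕ}
    (hW : IsPhaseLengths A δ Y Z W Pr) :
    ∀ᵐ ω ∂Pr, ∀ i, IsTimetable A ⌈1 + δ⌉₊ fun j => ∑ y ∈ Finset.range (j + 1), W ω i y := by
  filter_upwards [hW.ae_mem hδ] with ω hω i
  refine isTimetable_sum (fun j => (Finset.mem_Icc.1 (hω i j)).1) fun j => ?_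
  refine (Finset.mem_Icc.1 (hω i j)).2.trans (Nat.floor_le_of_le ?_)
  push_cast
  gcongr
  exact Nat.le_ceil _

end GosInE

theorem mainTheorem6 {N K : ℕ} [NeZero K] (hN : 2 ≤ N) (hK : 2 ≤ K)
    (μ : Fin K → ℝ) (hμ : IsBanditInstance μ)
    (P : Matrix (Fin N) (Fin N) ℝ) (hP : P ∈ Matrix.rowStochastic ℝ (Fin N))
    (hirr : P.IsIrreducible)
    (α : ℝ) (hα : 3 < α) (ε : ℝ) (hε : 0 < ε) (B : ℕ → ℝ) (hB : IsAdmissibleBudget B ε)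
    {Ω : Type*} [MeasurableSpace Ω] (Pr : Measure Ω) [IsProbabilityMeasure Pr]
    (tie : Ω → TieBreak N K) (htie : MeasurableTies tie)
    (Y : Ω → Fin N → Fin K → ℕ → Bool) (Z : Ω → Fin N → ℕ → Fin N)
    (hYZ : IsNoise μ P Y Z Pr) :
    (∀ i : Fin N,
      (∀ T : ℕ, Integrable
        (fun ω => syncRegret μ α (commSlot B ε) (tie ω) (Y ω) (Z ω) i T) Pr) ∧
      limsup (fun T : ℕ => (((∫ ω, syncRegret μ α (commSlot B ε) (tie ω) (Y ω) (Z ω) i T ∂Pr) /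
          Real.log T : ℝ) : EReal)) atTop ≤
        ((∑ l : Fin K with 1 ≤ l.val ∧ l.val ≤ K ⌈/⌉ N + 1, 4 * α / (μ 0 - μ l) : ℝ) : EReal)) ∧
    (∀ (δ : ℝ), 0 < δ → ∀ (W : Ω → Fin N → ℕ → ℕ),
      IsPhaseLengths (commSlot B ε) δ Y Z W Pr →
      ∀ i : Fin N,
        (∀ T : ℕ, Integrable
          (fun ω => asyncRegret μ α (tie ω) (Y ω) (Z ω) (W ω) i T) Pr) ∧
        limsup (fun T : ℕ => (((∫ ω, asyncRegret μ α (tie ω) (Y ω) (Z ω) (W ω) i T ∂Pr) /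
            Real.log T : ℝ) : EReal)) atTop ≤
          ((∑ l : Fin K with 1 ≤ l.val ∧ l.val ≤ K ⌈/⌉ N + 1, 4 * α / (μ 0 - μ l) : ℝ) :
            EReal)) := by
  have hN' : 0 < N := by omega
  have hP' : ∀ i m, 0 ≤ P i m := (Matrix.mem_rowStochastic.1 hP).1
  constructor
  · intro i
    exact limsup_regret_le (E := fun _ _ j => commSlot B ε j)
      (advice := fun st => argmaxSet st.active st.phasePulls) hN' hμ hP' hirr hα hε hB one_pos htie
      hYZ (fun _ _ => measurable_const)
      (ae_of_all _ fun _ _ => isTimetable_self (isConvexSchedule_commSlot hε hB))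
      (Or.inl ⟨rfl, fun _ _ _ => rfl⟩) i
  · intro δ hδ W hW i
    have hWm := hW.measurable
    have hEm : ∀ k j, Measurable fun ω => ∑ y ∈ Finset.range (j + 1), W ω k y :=
      fun k j => Finset.measurable_sum _ fun y _ => by fun_prop
    exact limsup_regret_le (E := fun ω k j => ∑ y ∈ Finset.range (j + 1), W ω k y)
      (advice := fun st => argmaxSet st.prevActive st.prevPulls) hN' hμ hP' hirr hα hε hB
      (Nat.ceil_pos.2 (by linarith)) htie hYZ hEm (hW.ae_isTimetable hδ.le) (Or.inr rfl) i
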